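/- **Notation.** For $x,\omega\in\mathbb R$ and $a>0$ let $T_xg(t)=g(t-x)$, $M_\omega g(t)=e^{2\pi i\omega t}g(t)$, $D_ag(t)=a^{-1/2}g(t/a)$, and let $\mathcal F g(\xi)=\int_{\mathbb R} g(t)e^{-2\pi i t\xi}\,dt$, extended to $\mathcal S'(\mathbb R)$. Let $\alpha\in[0,1]$. An *$\alpha$-covering* is a countable set $\mathcal I$ of intervals $I\subset\mathbb R$ with $\bigcup_{I\in\mathcal I}I=\mathbb R$, such that every $x\in\mathbb R$ lies in at most two of the intervals, and $|I|\asymp(1+|\xi|)^\alpha$ uniformly for all $I\in\mathcal I$ and $\xi\in I$. A *bounded admissible partition of unity* (BAPU) for $\mathcal I$ is a family $(\psi_I)_{I\in\mathcal I}$ in $\mathcal S(\mathbb R)$ with $\sup_I\|\mathcal F^{-1}\psi_I\|_{L^1}<\infty$, $\operatorname{supp}\psi_I\subset I$ and $\sum_{I}\psi_I=1$ on $\mathbb R$. Given an $\alpha$-covering $\mathcal I$, a BAPU $(\psi_I)$ and points $\omega_I\in I$, for $\sigma\in\mathbb R$ and $1\le p,q\le\infty$ the *$\alpha$-modulation space*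 $M^{\sigma,\alpha}_{p,q}(\mathbb R)$ is the set of $f\in\mathcal S'(\mathbb R)$ with $$\|f\|_{M^{\sigma,\alpha}_{p,q}}:=\Big(\sum_{I\in\mathcal I}\big\|\mathcal F^{-1}(\psi_I\,\mathcal F f)\big\|_{L^p}^q\,(1+|\omega_I|)^{\sigma q}\Big)^{1/q}<\infty ,$$ with the supremum over $I$ in place of the $\ell^q$ norm if $q=\infty$; the $L^p$ norm of a distribution not represented by a function in $L^p$ is $\infty$. For $c>0$, $g\in\mathcal S(\mathbb R)$ and $f\in\mathcal S'(\mathbb R)$ the *$\alpha$-transform* (flexible Gabor-wavelet transform) is $$V_g^\alpha f(x,\omega)=\big\langle f,\;T_xM_\omega D_{c(1+|\omega|)^{-\alpha}}g\big\rangle,\qquad x,\omega\in\mathbb R,$$ where $\langle\cdot,\cdot\rangle$ is antilinear in the second argument and extends the $L^2$ inner product. **Theorem.** Let $s\in\mathbb R$, $\alpha\in[0,1]$, $c>0$ and $1\le p,q\le\infty$ (with $1/\infty=0$). Then there is a band-limited $g\in\mathcal S(\mathbb R)\setminus\{0\}$ (that is, $\mathcal F g$ has compact support) such that, for every $\alpha$-covering,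 every BAPU for it and every choice of points $\omega_I\in I$ defining $M^{s+\alpha(1/q-1/2),\alpha}_{p,q}(\mathbb R)$, $$M^{s+\alpha(1/q-1/2),\alpha}_{p,q}(\mathbb R)=\big\{f\in\mathcal S'(\mathbb R):\;V_g^\alpha f\in L^{p,q}_m(\mathbb R^2)\big\},\qquad m(x,\omega)=(1+|\omega|)^s,$$ and there are constants $A,B>0$, not depending on $f$, such that for all $f$ in this space $$A\,\|V_g^\alpha f\|_{L^{p,q}_m}\le\|f\|_{M^{s+\alpha(1/q-1/2),\alpha}_{p,q}}\le B\,\|V_g^\alpha f\|_{L^{p,q}_m},$$ where $$\|F\|_{L^{p,q}_m}=\Big(\int_{\mathbb R}\Big(\int_{\mathbb R}|F(x,\omega)|^p\,dx\Big)^{q/p}(1+|\omega|)^{sq}\,d\omega\Big)^{1/q},$$ with the essential supremum in place of the integral in $x$ or in $\omega$ if $p=\infty$ or $q=\infty$. -/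

import Mathlib

open MeasureTheory
open scoped ENNReal NNReal SchwartzMap FourierTransform ComplexConjugate

noncomputable section

namespace AlphaMod

/-! ### Translation, modulation and dilation of Schwartz functions -/

/-- The character `t ↦ e^{2πiωt}` has temperate growth. -/
theorem hasTemperateGrowth_char (ω : ℝ) :
    Function.HasTemperateGrowth (fun t : ℝ => Complex.exp (2 * Real.pi * Complex.I * ω * t)) := by
  have hd : ∀ n : ℕ, iteratedDeriv n
      (fun t : ℝ => Complex.exp (2 * Real.pi * Complex.I * ω * t)) =
      fun t : ℝ => (2 * Real.pi * Complex.I * ω) ^ n *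
        Complex.exp (2 * Real.pi * Complex.I * ω * t) := by
    intro n
    induction n with
    | zero => ext t; simp
    | succ n ih =>
      rw [iteratedDeriv_succ, ih]
      ext t
      have h1 : HasDerivAt (fun t : ℝ => 2 * Real.pi * Complex.I * ω * (t : ℂ))
          (2 * Real.pi * Complex.I * ω) t := by
        simpa using (Complex.ofRealCLM.hasDerivAt (x := t)).const_mul
          (2 * Real.pi * Complex.I * ω : ℂ)
      rw [(h1.cexp.const_mul _).deriv]
      ring
  have hs : ContDiff ℝ (⊤ : ℕ∞)
      (fun t : ℝ => Complex.exp (2 * Real.pi * Complex.I * ω * t)) :=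
    (contDiff_const.mul Complex.ofRealCLM.contDiff).cexp
  refine ⟨hs, fun n => ⟨0, (‖(2 * Real.pi * Complex.I * ω : ℂ)‖) ^ n, fun t => ?_⟩⟩
  rw [norm_iteratedFDeriv_eq_norm_iteratedDeriv, hd]
  have h2 : ‖Complex.exp (2 * Real.pi * Complex.I * ω * t)‖ = 1 := by
    rw [Complex.norm_exp]; simp
  simp only [norm_mul, norm_pow, h2, mul_one, pow_zero]
  exact le_rfl

/-- Translation `(T_x g)(t) = g(t - x)`. -/
def translation (x : ℝ) (g : 𝓢(ℝ, ℂ)) : 𝓢(ℝ, ℂ) :=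
  SchwartzMap.compSubConstCLM ℂ x g

/-- Modulation `(M_ω g)(t) = e^{2πiωt} g(t)`. -/
def modulation (ω : ℝ) (g : 𝓢(ℝ, ℂ)) : 𝓢(ℝ, ℂ) :=
  SchwartzMap.smulLeftCLM ℂ (fun t : ℝ => Complex.exp (2 * Real.pi * Complex.I * ω * t)) g

/-- Dilation `(D_a g)(t) = a^{-1/2} g(t / a)`, for `a > 0`. -/
def dilation (a : ℝ) (ha : 0 < a) (g : 𝓢(ℝ, ℂ)) : 𝓢(ℝ, ℂ) :=
  ((a ^ (-(1 / 2) : ℝ) : ℝ) : ℂ) •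
    SchwartzMap.compCLMOfContinuousLinearEquiv ℂ
      (ContinuousLinearEquiv.unitsEquivAut ℝ (Units.mk0 a⁻¹ (inv_pos.2 ha).ne')) g

/-- Complex conjugation of a Schwartz function. -/
def conjSchwartz (g : 𝓢(ℝ, ℂ)) : 𝓢(ℝ, ℂ) :=
  SchwartzMap.postcompCLM (𝕜 := ℝ) (Complex.conjCLE : ℂ →L[ℝ] ℂ) g

theorem translation_apply (x : ℝ) (g : 𝓢(ℝ, ℂ)) (t : ℝ) : translation x g t = g (t - x) := rfl

theorem modulation_apply (ω : ℝ) (g : 𝓢(ℝ, ℂ)) (t : ℝ) :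
    modulation ω g t = Complex.exp (2 * Real.pi * Complex.I * ω * t) * g t := by
  simp [modulation, SchwartzMap.smulLeftCLM_apply_apply (hasTemperateGrowth_char ω)]

theorem dilation_apply (a : ℝ) (ha : 0 < a) (g : 𝓢(ℝ, ℂ)) (t : ℝ) :
    dilation a ha g t = ((a ^ (-(1 / 2) : ℝ) : ℝ) : ℂ) * g (t / a) := by
  simp [dilation, div_eq_mul_inv]

theorem conjSchwartz_apply (g : 𝓢(ℝ, ℂ)) (t : ℝ) : conjSchwartz g t = conj (g t) := rfl

/-! ### The flexible Gabor-wavelet transform -/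

theorem scale_pos {c : ℝ} (hc : 0 < c) (α ω : ℝ) : 0 < c * (1 + |ω|) ^ (-α) := by positivity

/-- The atom `T_x M_ω D_{c (1 + |ω|)^{-α}} g`. -/
def atom (α c : ℝ) (hc : 0 < c) (g : 𝓢(ℝ, ℂ)) (x ω : ℝ) : 𝓢(ℝ, ℂ) :=
  translation x (modulation ω (dilation (c * (1 + |ω|) ^ (-α)) (scale_pos hc α ω) g))

/-- The α-transform `V_g^α f (x, ω) = ⟨f, T_x M_ω D_{c (1 + |ω|)^{-α}} g⟩` of a tempered
distribution `f`; the pairing is antilinear in the second slot, i.e. `f` is applied to the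
complex conjugate of the atom. -/
def alphaTransform (α c : ℝ) (hc : 0 < c) (g : 𝓢(ℝ, ℂ)) (f : 𝓢'(ℝ, ℂ)) (z : ℝ × ℝ) : ℂ :=
  f (conjSchwartz (atom α c hc g z.1 z.2))

/-- On Schwartz functions the α-transform is the integral of `f` against the conjugate atom. -/
theorem alphaTransform_schwartz (α c : ℝ) (hc : 0 < c) (g f : 𝓢(ℝ, ℂ)) (z : ℝ × ℝ) :
    alphaTransform α c hc g (f : 𝓢'(ℝ, ℂ)) z = ∫ t, f t * conj (atom α c hc g z.1 z.2 t) := by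
  simp [alphaTransform, conjSchwartz_apply, mul_comm]

/-- A Schwartz function is band-limited if its Fourier transform has compact support. -/
def IsBandLimited (g : 𝓢(ℝ, ℂ)) : Prop := HasCompactSupport (𝓕 g : 𝓢(ℝ, ℂ))

/-! ### Weighted mixed-norm spaces -/

/-- The norm of `L^{p,q}_m(ℝ²)`: the `L^p` norm of `m F` in the first variable `x`, then the `L^q`
norm in the second variable `ω`. -/
def mixedNorm (p q : ℝ≥0∞) (m : ℝ × ℝ → ℝ) (F : ℝ × ℝ → ℂ) : ℝ≥0∞ :=
  eLpNorm (fun ω : ℝ => eLpNorm (fun x : ℝ => (m (x, ω) : ℂ) * F (x, ω)) p volume) q volume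

/-- Membership in `L^{p,q}_m(ℝ²)`. -/
def MemMixed (p q : ℝ≥0∞) (m : ℝ × ℝ → ℝ) (F : ℝ × ℝ → ℂ) : Prop :=
  AEStronglyMeasurable F volume ∧ mixedNorm p q m F < ∞

/-- The weight `m(x, ω) = (1 + |ω|)^s`. -/
def freqWeight (s : ℝ) (z : ℝ × ℝ) : ℝ := (1 + |z.2|) ^ s

/-! ### α-coverings, partitions of unity and α-modulation spaces -/

/-- An α-covering of `ℝ`: a countable set of intervals that covers `ℝ`, such that every point
lies in at most two of them and `|I| ≍ (1 + |ξ|)^α` uniformly in `I` and in `ξ ∈ I`. -/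
structure IsAlphaCovering (α : ℝ) (𝓘 : Set (Set ℝ)) : Prop where
  countable : 𝓘.Countable
  interval : ∀ I ∈ 𝓘, I.OrdConnected
  covers : ⋃₀ 𝓘 = Set.univ
  overlap : ∀ x : ℝ, {I ∈ 𝓘 | x ∈ I}.encard ≤ 2
  size : ∃ A B : ℝ, 0 < A ∧ 0 < B ∧ ∀ I ∈ 𝓘, ∀ ξ ∈ I,
    ENNReal.ofReal (A * (1 + |ξ|) ^ α) ≤ volume I ∧
      volume I ≤ ENNReal.ofReal (B * (1 + |ξ|) ^ α)

/-- A bounded admissible partition of unity subordinate to `𝓘`, made of Schwartz functions. The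
norm of `𝓕L¹` is the `L¹` norm of the inverse Fourier transform. -/
structure IsBAPU (𝓘 : Set (Set ℝ)) (ψ : 𝓘 → 𝓢(ℝ, ℂ)) : Prop where
  bounded : ∃ C : ℝ≥0, ∀ I : 𝓘, eLpNorm (𝓕⁻ (ψ I) : 𝓢(ℝ, ℂ)) 1 volume ≤ C
  supp : ∀ I : 𝓘, tsupport (ψ I) ⊆ I
  sum_eq_one : ∀ ξ : ℝ, HasSum (fun I : 𝓘 => ψ I ξ) 1

/-- The segmentation operator `P f = 𝓕⁻¹(ψ 𝓕 f)` on tempered distributions. -/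
def segmentation (ψ : 𝓢(ℝ, ℂ)) (f : 𝓢'(ℝ, ℂ)) : 𝓢'(ℝ, ℂ) :=
  𝓕⁻ (TemperedDistribution.smulLeftCLM ℂ ψ (𝓕 f))

/-- The `L^p` norm of a tempered distribution: the `L^p` norm of a function in `L^p` that
represents it, and `∞` if there is none. -/
def distLpNorm (p : ℝ≥0∞) (T : 𝓢'(ℝ, ℂ)) : ℝ≥0∞ :=
  ⨅ (u : ℝ → ℂ) (_ : MemLp u p volume ∧ ∀ φ : 𝓢(ℝ, ℂ), T φ = ∫ x, φ x * u x),
    eLpNorm u p volume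

/-- The `ℓ^q` norm of a family of extended nonnegative numbers. -/
def lqNorm {ι : Type*} (q : ℝ≥0∞) (a : ι → ℝ≥0∞) : ℝ≥0∞ :=
  if q = ∞ then ⨆ i, a i else (∑' i, a i ^ q.toReal) ^ (1 / q.toReal)

/-- The norm of `M_{p,q}^{s,α}(ℝ)`, with respect to a covering `𝓘`, a partition of unity `ψ` and
points `ω I ∈ I`. -/
def modNorm (𝓘 : Set (Set ℝ)) (ψ : 𝓘 → 𝓢(ℝ, ℂ)) (ω : 𝓘 → ℝ) (p q : ℝ≥0∞) (s : ℝ)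
    (f : 𝓢'(ℝ, ℂ)) : ℝ≥0∞ :=
  lqNorm q fun I : 𝓘 => distLpNorm p (segmentation (ψ I) f) * ENNReal.ofReal ((1 + |ω I|) ^ s)

/-- The space `M_{p,q}^{s,α}(ℝ)`; the parameter `α` enters through the α-covering `𝓘`. -/
def modSpace (𝓘 : Set (Set ℝ)) (ψ : 𝓘 → 𝓢(ℝ, ℂ)) (ω : 𝓘 → ℝ) (p q : ℝ≥0∞) (s : ℝ) :
    Set 𝓢'(ℝ, ℂ) :=
  {f | modNorm 𝓘 ψ ω p q s f < ∞}

end AlphaMod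

end

/-!
For fixed `ω`, the function `V_g^α f (·, ω)` equals `𝓕⁻¹ (φ 𝓕 f)`, where the symbol `φ` is, up to a
constant multiple, `ξ ↦ conj (𝓕 g ((ξ - ω) / h))` with `h` comparable to `(1 + |ω|) ^ α`. So both
norms measure pieces of `f` cut out by frequency windows of the same widths, one piece for every
`ω ∈ ℝ` on one side and one for every interval of the covering on the other.

If `𝓕 g` is supported in the open ball of radius `c`, the support of `φ` meets only boundedly many
intervals, and the partition of unity bounds the piece at `ω` by the pieces of these intervals. If
`𝓕 g 0 ≠ 0`, then `φ` is invertible on a window of width `δ (1 + |ω|) ^ α`. A translation partition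
divides the piece of an interval `I` into boundedly many narrower ones, and a dominating one among
them is controlled by `V_g^α f (·, ω)` for all `ω` in an interval of length comparable to `|I|`. In
both cases Young's inequality with `‖𝓕⁻¹ χ‖₁` bounds the multipliers on `L^p`, also for `p = ∞`.
The factors `(1 + |ω|) ^ (α / q)` and `(1 + |ω|) ^ (-α / 2)` come from passing between the integral
over `ω` and the sum over `I`, and from the `L²` normalization of the dilations.
-/

noncomputable section

namespace AlphaMod

open SchwartzMap
open scoped BoundedContinuousFunction

section Factorization

theorem exists_continuousLinearMap_comp_eq {𝕜 V E : Type*} [RCLike 𝕜] [AddCommGroup V] [Module 𝕜 V]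
    [NormedAddCommGroup E] [NormedSpace 𝕜 E] (f : V →ₗ[𝕜] 𝕜) (L : V →ₗ[𝕜] E) {C : ℝ}
    (hf : ∀ v, ‖f v‖ ≤ C * ‖L v‖) : ∃ F : E →L[𝕜] 𝕜, ∀ v, f v = F (L v) := by
  have hker : LinearMap.ker L ≤ LinearMap.ker f := fun v hv => by
    have hLv : L v = 0 := hv
    simpa [hLv] using hf v
  let φ : LinearMap.range L →ₗ[𝕜] 𝕜 :=
    (LinearMap.ker L).liftQ f hker ∘ₗ (L.quotKerEquivRange.symm : LinearMap.range L →ₗ[𝕜] _)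
  have hφ (v : V) : φ ⟨L v, v, rfl⟩ = f v := by
    have : L.quotKerEquivRange.symm ⟨L v, v, rfl⟩ = (LinearMap.ker L).mkQ v := by
      rw [LinearEquiv.symm_apply_eq]; rfl
    simp only [φ, LinearMap.comp_apply, LinearEquiv.coe_coe, this, Submodule.mkQ_apply,
      Submodule.liftQ_apply]
  have hφ_le (w : LinearMap.range L) : ‖φ w‖ ≤ C * ‖w‖ := by
    obtain ⟨_, v, rfl⟩ := w
    exact (hφ v).symm ▸ hf v
  obtain ⟨F, hF, -⟩ := exists_extension_norm_eq (LinearMap.range L) (φ.mkContinuous C hφ_le)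
  exact ⟨F, fun v => (hφ v).symm.trans (hF ⟨L v, v, rfl⟩).symm⟩

theorem hasTemperateGrowth_ofReal_pow (k : ℕ) :
    Function.HasTemperateGrowth (fun t : ℝ => (t : ℂ) ^ k) := by
  have : Function.HasTemperateGrowth (fun t : ℝ => (t : ℂ)) := Complex.ofRealCLM.hasTemperateGrowth
  fun_prop

/-- The map `G ↦ t ^ k * G⁽ⁿ⁾(t)` into the bounded continuous functions; the norms of these maps
control the Schwartz seminorms. -/
def weightedDeriv (k n : ℕ) : 𝓢(ℝ, ℂ) →L[ℂ] (ℝ →ᵇ ℂ) :=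
  toBoundedContinuousFunctionCLM ℂ ℝ ℂ ∘L
    smulLeftCLM ℂ (fun t : ℝ => (t : ℂ) ^ k) ∘L derivCLM ℂ ℂ ^ n

theorem weightedDeriv_apply (k n : ℕ) (G : 𝓢(ℝ, ℂ)) (t : ℝ) :
    weightedDeriv k n G t = (t : ℂ) ^ k * (derivCLM ℂ ℂ ^ n) G t := by
  simp [weightedDeriv, smulLeftCLM_apply_apply (hasTemperateGrowth_ofReal_pow k)]

theorem derivCLM_pow_apply (n : ℕ) (G : 𝓢(ℝ, ℂ)) (t : ℝ) :
    (derivCLM ℂ ℂ ^ n) G t = iteratedDeriv n G t := by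
  induction n generalizing G with
  | zero => simp
  | succ n ih =>
    rw [pow_succ, iteratedDeriv_succ']
    exact ih (derivCLM ℂ ℂ G)

theorem seminorm_le_norm_weightedDeriv (k n : ℕ) (G : 𝓢(ℝ, ℂ)) :
    SchwartzMap.seminorm ℂ k n G ≤ ‖weightedDeriv k n G‖ := by
  refine seminorm_le_bound' ℂ k n G (norm_nonneg _) fun t => ?_
  have := (weightedDeriv k n G).norm_coe_le_norm t
  rwa [weightedDeriv_apply, derivCLM_pow_apply, norm_mul, norm_pow, Complex.norm_real,
    Real.norm_eq_abs] at this

theorem exists_eq_apply_weightedDeriv (f : 𝓢'(ℝ, ℂ)) :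
    ∃ (s : Finset (ℕ × ℕ)) (F : (s → (ℝ →ᵇ ℂ)) →L[ℂ] ℂ),
      ∀ G : 𝓢(ℝ, ℂ), f G = F fun i => weightedDeriv i.1.1 i.1.2 G := by
  obtain ⟨s, C, -, hf⟩ := Seminorm.bound_of_continuous (schwartz_withSeminorms ℂ ℝ ℂ)
    ((normSeminorm ℂ ℂ).comp (f : 𝓢(ℝ, ℂ) →ₗ[ℂ] ℂ)) (map_continuous f).norm
  let L : 𝓢(ℝ, ℂ) →ₗ[ℂ] (s → (ℝ →ᵇ ℂ)) :=
    LinearMap.pi fun i => (weightedDeriv i.1.1 i.1.2 : 𝓢(ℝ, ℂ) →ₗ[ℂ] (ℝ →ᵇ ℂ))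
  have hfL (G : 𝓢(ℝ, ℂ)) : ‖f G‖ ≤ C * ‖L G‖ := by
    refine (hf G).trans (mul_le_mul_of_nonneg_left ?_ C.2)
    exact Seminorm.finset_sup_apply_le (norm_nonneg _) fun i hi =>
      (seminorm_le_norm_weightedDeriv i.1 i.2 G).trans (norm_le_pi_norm (L G) ⟨i, hi⟩)
  obtain ⟨F, hF⟩ := exists_continuousLinearMap_comp_eq (f : 𝓢(ℝ, ℂ) →ₗ[ℂ] ℂ) L hfL
  exact ⟨s, F, hF⟩

end Factorization

section Translation

theorem norm_toBoundedContinuousFunctionCLM_translation_le (H : 𝓢(ℝ, ℂ)) (x : ℝ) :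
    ‖toBoundedContinuousFunctionCLM ℂ ℝ ℂ (translation x H)‖ ≤
      ‖toBoundedContinuousFunctionCLM ℂ ℝ ℂ H‖ :=
  (BoundedContinuousFunction.norm_le (norm_nonneg _)).2 fun t =>
    (toBoundedContinuousFunctionCLM ℂ ℝ ℂ H).norm_coe_le_norm (t - x)

theorem continuous_toBoundedContinuousFunctionCLM_translation (H : 𝓢(ℝ, ℂ)) :
    Continuous fun x => toBoundedContinuousFunctionCLM ℂ ℝ ℂ (translation x H) := by
  have hH : UniformContinuous H := ZeroAtInftyContinuousMap.uniformContinuous H.toZeroAtInfty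
  refine Metric.continuous_iff.2 fun x ε hε => ?_
  obtain ⟨δ, hδ, h⟩ := Metric.uniformContinuous_iff.1 hH (ε / 2) (half_pos hε)
  refine ⟨δ, hδ, fun y hy => lt_of_le_of_lt
    ((BoundedContinuousFunction.dist_le (half_pos hε).le).2 fun t => ?_) (half_lt_self hε)⟩
  exact (h (by rwa [dist_sub_left] : dist (t - y) (t - x) < δ)).le

theorem derivCLM_pow_translation (n : ℕ) (x : ℝ) (G : 𝓢(ℝ, ℂ)) :
    (derivCLM ℂ ℂ ^ n) (translation x G) = translation x ((derivCLM ℂ ℂ ^ n) G) := by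
  ext t
  rw [translation_apply, derivCLM_pow_apply, derivCLM_pow_apply]
  exact congrFun (iteratedDeriv_comp_sub_const n G x) t

theorem weightedDeriv_translation (k n : ℕ) (x : ℝ) (G : 𝓢(ℝ, ℂ)) :
    weightedDeriv k n (translation x G) = ∑ j ∈ Finset.range (k + 1),
      ((x : ℂ) ^ (k - j) * k.choose j) • toBoundedContinuousFunctionCLM ℂ ℝ ℂ
        (translation x (smulLeftCLM ℂ (fun t : ℝ => (t : ℂ) ^ j) ((derivCLM ℂ ℂ ^ n) G))) := by
  ext t
  have hbinom := add_pow ((t : ℂ) - x) x k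
  rw [sub_add_cancel] at hbinom
  rw [weightedDeriv_apply, derivCLM_pow_translation, hbinom, Finset.sum_mul,
    BoundedContinuousFunction.sum_apply]
  refine Finset.sum_congr rfl fun j _ => ?_
  simp only [translation_apply, BoundedContinuousFunction.smul_apply,
    toBoundedContinuousFunctionCLM_apply, smul_eq_mul, Complex.ofReal_sub,
    smulLeftCLM_apply_apply (hasTemperateGrowth_ofReal_pow j)]
  ring

theorem continuous_weightedDeriv_translation (k n : ℕ) (G : 𝓢(ℝ, ℂ)) :
    Continuous fun x => weightedDeriv k n (translation x G) := by
  simp only [weightedDeriv_translation]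
  exact continuous_finsetSum _ fun j _ => (by fun_prop : Continuous fun x : ℝ =>
    (x : ℂ) ^ (k - j) * (k.choose j : ℂ)).smul
      (continuous_toBoundedContinuousFunctionCLM_translation _)

theorem continuous_apply_translation (f : 𝓢'(ℝ, ℂ)) (G : 𝓢(ℝ, ℂ)) :
    Continuous fun x => f (translation x G) := by
  obtain ⟨s, F, hF⟩ := exists_eq_apply_weightedDeriv f
  simp only [hF]
  exact F.continuous.comp (continuous_pi fun i => continuous_weightedDeriv_translation _ _ G)

theorem integrable_smul_weightedDeriv_translation (k n : ℕ) (φ G : 𝓢(ℝ, ℂ)) :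
    Integrable fun x => φ x • weightedDeriv k n (translation x G) := by
  simp only [weightedDeriv_translation, Finset.smul_sum, smul_smul]
  refine integrable_finsetSum _ fun j _ => ?_
  let ψ : 𝓢(ℝ, ℂ) := (k.choose j : ℂ) • smulLeftCLM ℂ (fun x : ℝ => (x : ℂ) ^ (k - j)) φ
  have hψ (x : ℝ) : φ x * ((x : ℂ) ^ (k - j) * k.choose j) = ψ x := by
    simp only [ψ, smul_apply, smulLeftCLM_apply_apply (hasTemperateGrowth_ofReal_pow (k - j)),
      smul_eq_mul]
    ring
  simp only [hψ]
  exact ψ.integrable.smul_bdd _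
    (continuous_toBoundedContinuousFunctionCLM_translation _).aestronglyMeasurable
    (ae_of_all _ fun x => norm_toBoundedContinuousFunctionCLM_translation_le _ x)

end Translation

section Convolution

theorem convolution_mul_apply (φ G : 𝓢(ℝ, ℂ)) (t : ℝ) :
    SchwartzMap.convolution (.mul ℂ ℂ) φ G t = ∫ x, φ x * translation x G t :=
  SchwartzMap.convolution_apply _ φ G t

theorem derivCLM_convolution (φ G : 𝓢(ℝ, ℂ)) :
    derivCLM ℂ ℂ (SchwartzMap.convolution (.mul ℂ ℂ) φ G) =
      SchwartzMap.convolution (.mul ℂ ℂ) φ (derivCLM ℂ ℂ G) := by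
  have hderiv (H : 𝓢(ℝ, ℂ)) : derivCLM ℂ ℂ H = LineDeriv.lineDerivOp (1 : ℝ) H := by
    ext x
    rw [lineDerivOp_apply_eq_fderiv, derivCLM_apply, fderiv_eq_smul_deriv, one_smul]
  have hgrowth : Function.HasTemperateGrowth fun ξ : ℝ => inner ℝ ξ (1 : ℝ) := by fun_prop
  apply (FourierTransform.fourierEquiv ℂ 𝓢(ℝ, ℂ)).injective
  ext ξ
  simp only [hderiv, FourierTransform.fourierEquiv_apply, fourier_lineDerivOp_eq,
    fourier_convolution, smul_apply, smulLeftCLM_apply_apply hgrowth, pairing_apply_apply,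
    ContinuousLinearMap.mul_apply', smul_eq_mul, Complex.real_smul]
  ring

theorem derivCLM_pow_convolution (n : ℕ) (φ G : 𝓢(ℝ, ℂ)) :
    (derivCLM ℂ ℂ ^ n) (SchwartzMap.convolution (.mul ℂ ℂ) φ G) =
      SchwartzMap.convolution (.mul ℂ ℂ) φ ((derivCLM ℂ ℂ ^ n) G) := by
  induction n with
  | zero => rfl
  | succ n ih => simp only [pow_succ', mul_apply_eq_comp, ih, derivCLM_convolution]

theorem weightedDeriv_convolution (k n : ℕ) (φ G : 𝓢(ℝ, ℂ)) :
    weightedDeriv k n (SchwartzMap.convolution (.mul ℂ ℂ) φ G) =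
      ∫ x, φ x • weightedDeriv k n (translation x G) := by
  ext t
  rw [← BoundedContinuousFunction.evalCLM_apply ℂ t (∫ x, _),
    ← ContinuousLinearMap.integral_comp_comm _ (integrable_smul_weightedDeriv_translation k n φ G),
    weightedDeriv_apply, derivCLM_pow_convolution, convolution_mul_apply, ← integral_const_mul]
  refine integral_congr_ae (ae_of_all _ fun x => ?_)
  simp only [BoundedContinuousFunction.evalCLM_apply, BoundedContinuousFunction.smul_apply,
    weightedDeriv_apply, derivCLM_pow_translation, smul_eq_mul]
  ring

theorem apply_convolution (f : 𝓢'(ℝ, ℂ)) (φ G : 𝓢(ℝ, ℂ)) :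
    f (SchwartzMap.convolution (.mul ℂ ℂ) φ G) = ∫ x, φ x * f (translation x G) := by
  obtain ⟨s, F, hF⟩ := exists_eq_apply_weightedDeriv f
  let u (x : ℝ) (i : s) : ℝ →ᵇ ℂ := weightedDeriv i.1.1 i.1.2 (translation x G)
  have hu (i : s) : Integrable fun x => (φ x • u x) i :=
    integrable_smul_weightedDeriv_translation _ _ φ G
  have hpull : (fun i : s => weightedDeriv i.1.1 i.1.2
      (SchwartzMap.convolution (.mul ℂ ℂ) φ G)) = ∫ x, φ x • u x := by
    funext i
    rw [weightedDeriv_convolution]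
    exact (eval_integral hu i).symm
  rw [hF, hpull]
  refine (F.integral_comp_comm (Integrable.of_eval hu)).symm.trans ?_
  simp only [map_smul, hF, smul_eq_mul, u]

end Convolution

section Young

theorem lintegral_mul_rpow_le {X : Type*} [MeasurableSpace X] {μ : Measure X} {f g : X → ℝ≥0∞}
    (hf : AEMeasurable f μ) (hg : AEMeasurable g μ) {r : ℝ} (hr : 1 ≤ r) :
    (∫⁻ x, f x * g x ∂μ) ^ r ≤ (∫⁻ x, f x ∂μ) ^ (r - 1) * ∫⁻ x, f x * g x ^ r ∂μ := by
  have hr0 : 0 < r := zero_lt_one.trans_le hr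
  have hr1 : 0 ≤ 1 - 1 / r := by rw [sub_nonneg, div_le_one hr0]; exact hr
  have hfg (x : X) : f x * g x = f x ^ (1 - 1 / r) * (f x * g x ^ r) ^ (1 / r) := by
    rw [ENNReal.mul_rpow_of_nonneg _ _ (by positivity), ← mul_assoc,
      ← ENNReal.rpow_add_of_nonneg _ _ hr1 (by positivity), ← ENNReal.rpow_mul,
      mul_one_div_cancel hr0.ne', sub_add_cancel, ENNReal.rpow_one, ENNReal.rpow_one]
  calc (∫⁻ x, f x * g x ∂μ) ^ r
      ≤ ((∫⁻ x, f x ∂μ) ^ (1 - 1 / r) * (∫⁻ x, f x * g x ^ r ∂μ) ^ (1 / r)) ^ r := by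
        simp only [hfg]
        gcongr
        exact ENNReal.lintegral_mul_norm_pow_le hf (hf.mul (hg.pow_const r)) hr1 (by positivity)
          (sub_add_cancel _ _)
    _ = (∫⁻ x, f x ∂μ) ^ (r - 1) * ∫⁻ x, f x * g x ^ r ∂μ := by
        rw [ENNReal.mul_rpow_of_nonneg _ _ hr0.le, ← ENNReal.rpow_mul, ← ENNReal.rpow_mul,
          one_div_mul_cancel hr0.ne', ENNReal.rpow_one, sub_mul, one_mul,
          one_div_mul_cancel hr0.ne']

variable {G : Type*} [AddCommGroup G] [MeasurableSpace G] [MeasurableAdd₂ G] [MeasurableNeg G]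
  {μ : Measure G} [SFinite μ] [μ.IsAddLeftInvariant] {f g : G → ℝ≥0∞}

theorem lintegral_lconvolution (hf : Measurable f) (hg : Measurable g) :
    ∫⁻ x, (f ⋆ₗ[μ] g) x ∂μ = (∫⁻ x, f x ∂μ) * ∫⁻ x, g x ∂μ := by
  simp only [lconvolution_def]
  rw [lintegral_lintegral_swap (by fun_prop), ← lintegral_mul_const _ hf]
  refine lintegral_congr fun y => ?_
  rw [lintegral_const_mul _ (by fun_prop), lintegral_add_left_eq_self]

theorem eLpNormEssSup_lconvolution_le (hf : Measurable f) :
    eLpNormEssSup (f ⋆ₗ[μ] g) μ ≤ (∫⁻ x, f x ∂μ) * eLpNormEssSup g μ := by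
  refine essSup_le_of_ae_le _ (ae_of_all _ fun x => ?_)
  change ∫⁻ y, f y * g (-y + x) ∂μ ≤ _ * _
  rw [← lintegral_mul_const _ hf]
  have hg : ∀ᵐ y ∂μ, g (-y + x) ≤ eLpNormEssSup g μ := by
    simpa only [neg_add_eq_sub, enorm_eq_self] using
      (quasiMeasurePreserving_sub_left μ x).ae (enorm_ae_le_eLpNormEssSup g μ)
  exact lintegral_mono_ae (hg.mono fun y hy => mul_le_mul_right hy _)

theorem eLpNorm_lconvolution_le (hf : Measurable f) (hg : Measurable g) {p : ℝ≥0∞} (hp : 1 ≤ p) :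
    eLpNorm (f ⋆ₗ[μ] g) p μ ≤ (∫⁻ x, f x ∂μ) * eLpNorm g p μ := by
  rcases eq_or_ne p ∞ with rfl | hp_top
  · simpa only [eLpNorm_exponent_top] using eLpNormEssSup_lconvolution_le hf
  have hp0 : p ≠ 0 := (zero_lt_one.trans_le hp).ne'
  have hr : 1 ≤ p.toReal := by rwa [← ENNReal.toReal_one, ENNReal.toReal_le_toReal (by simp) hp_top]
  have hr0 : 0 < p.toReal := zero_lt_one.trans_le hr
  simp only [eLpNorm_eq_lintegral_rpow_enorm_toReal hp0 hp_top, enorm_eq_self]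
  simp only [one_div]
  rw [ENNReal.rpow_inv_le_iff hr0, ENNReal.mul_rpow_of_nonneg _ _ hr0.le,
    ENNReal.rpow_inv_rpow hr0.ne']
  calc ∫⁻ x, (f ⋆ₗ[μ] g) x ^ p.toReal ∂μ
      ≤ ∫⁻ x, (∫⁻ y, f y ∂μ) ^ (p.toReal - 1) * (f ⋆ₗ[μ] fun y => g y ^ p.toReal) x ∂μ :=
        lintegral_mono fun x => lintegral_mul_rpow_le hf.aemeasurable (by fun_prop) hr
    _ = (∫⁻ y, f y ∂μ) ^ (p.toReal - 1) *
          ((∫⁻ y, f y ∂μ) * ∫⁻ y, g y ^ p.toReal ∂μ) := by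
        rw [lintegral_const_mul _ (measurable_lconvolution _ hf (hg.pow_const _)),
          lintegral_lconvolution hf (hg.pow_const _)]
    _ = (∫⁻ y, f y ∂μ) ^ p.toReal * ∫⁻ y, g y ^ p.toReal ∂μ := by
        nth_rw 2 [← ENNReal.rpow_one (∫⁻ y, f y ∂μ)]
        rw [← mul_assoc, ← ENNReal.rpow_add_of_nonneg _ _ (sub_nonneg.2 hr) zero_le_one,
          sub_add_cancel]

end Young

section Segments

theorem smulLeftCLM_schwartz_apply (χ ψ : 𝓢(ℝ, ℂ)) (ξ : ℝ) :
    smulLeftCLM ℂ χ ψ ξ = χ ξ * ψ ξ :=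
  smulLeftCLM_apply_apply χ.hasTemperateGrowth ψ ξ

theorem fourierInv_eq_fourier_neg (φ : 𝓢(ℝ, ℂ)) (ξ : ℝ) : 𝓕⁻ φ ξ = 𝓕 φ (-ξ) := by
  rw [fourierInv_coe, fourier_coe, Real.fourierInv_eq_fourier_neg]

theorem fourierInv_convolution_apply (φ G : 𝓢(ℝ, ℂ)) (ξ : ℝ) :
    𝓕⁻ (SchwartzMap.convolution (.mul ℂ ℂ) φ G) ξ = 𝓕⁻ φ ξ * 𝓕⁻ G ξ := by
  simp only [fourierInv_eq_fourier_neg, fourier_convolution, pairing_apply_apply,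
    ContinuousLinearMap.mul_apply']

theorem fourier_smulLeftCLM (χ ψ : 𝓢(ℝ, ℂ)) :
    𝓕 (smulLeftCLM ℂ χ ψ) = SchwartzMap.convolution (.mul ℂ ℂ) (𝓕 ψ) (𝓕 χ) := by
  apply (FourierTransform.fourierEquiv ℂ 𝓢(ℝ, ℂ)).symm.injective
  ext ξ
  simp only [FourierTransform.fourierEquiv_symm_apply, fourierInv_convolution_apply,
    FourierTransform.fourierInv_fourier_eq, smulLeftCLM_schwartz_apply, mul_comm]

theorem translation_convolution (x : ℝ) (φ G : 𝓢(ℝ, ℂ)) :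
    translation x (SchwartzMap.convolution (.mul ℂ ℂ) φ G) =
      SchwartzMap.convolution (.mul ℂ ℂ) (translation x φ) G := by
  ext t
  simp only [translation_apply, convolution_mul_apply]
  rw [← integral_sub_right_eq_self _ x]
  simp only [sub_sub, add_sub_cancel]

/-- The function `𝓕⁻¹ ψ * f` that represents the distribution `segmentation ψ f`. -/
def segmentFun (ψ : 𝓢(ℝ, ℂ)) (f : 𝓢'(ℝ, ℂ)) (x : ℝ) : ℂ := f (translation x (𝓕 ψ))

theorem continuous_segmentFun (ψ : 𝓢(ℝ, ℂ)) (f : 𝓢'(ℝ, ℂ)) : Continuous (segmentFun ψ f) :=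
  continuous_apply_translation f _

theorem segmentation_apply (ψ φ : 𝓢(ℝ, ℂ)) (f : 𝓢'(ℝ, ℂ)) :
    segmentation ψ f φ = ∫ x, φ x * segmentFun ψ f x := by
  change f (𝓕 (smulLeftCLM ℂ ψ (𝓕⁻ φ))) = _
  rw [fourier_smulLeftCLM, FourierTransform.fourier_fourierInv_eq, apply_convolution]
  rfl

theorem distLpNorm_eq_eLpNorm {p : ℝ≥0∞} (hp : 1 ≤ p) {T : 𝓢'(ℝ, ℂ)} {u : ℝ → ℂ}
    (hu : LocallyIntegrable u) (hT : ∀ φ : 𝓢(ℝ, ℂ), T φ = ∫ x, φ x * u x) :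
    distLpNorm p T = eLpNorm u p volume := by
  refine le_antisymm ?_ (le_iInf₂ fun v hv => ?_)
  · by_cases hup : MemLp u p volume
    · exact iInf₂_le u ⟨hup, hT⟩
    · have : eLpNorm u p volume = ∞ :=
        not_lt_top_iff.1 fun h => hup ⟨hu.aestronglyMeasurable, h⟩
      exact this ▸ le_top
  · refine (eLpNorm_congr_ae (ae_eq_of_integral_contDiff_smul_eq (hv.1.locallyIntegrable hp)
      hu fun g hg hgc => ?_)).ge
    let φ : 𝓢(ℝ, ℂ) := HasCompactSupport.toSchwartzMap (f := fun x => (g x : ℂ))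
      (hgc.comp_left Complex.ofReal_zero) (Complex.ofRealCLM.contDiff.comp hg)
    simp only [Complex.real_smul]
    exact (hv.2 φ).symm.trans (hT φ)

theorem distLpNorm_segmentation {p : ℝ≥0∞} (hp : 1 ≤ p) (ψ : 𝓢(ℝ, ℂ)) (f : 𝓢'(ℝ, ℂ)) :
    distLpNorm p (segmentation ψ f) = eLpNorm (segmentFun ψ f) p volume :=
  distLpNorm_eq_eLpNorm hp (continuous_segmentFun ψ f).locallyIntegrable
    fun φ => segmentation_apply ψ φ f

theorem segmentFun_smul (a : ℂ) (ψ : 𝓢(ℝ, ℂ)) (f : 𝓢'(ℝ, ℂ)) :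
    segmentFun (a • ψ) f = a • segmentFun ψ f := by
  funext x
  simp [segmentFun, translation, FourierTransform.fourier_smul]

theorem segmentFun_sum {ι : Type*} (s : Finset ι) (ψ : ι → 𝓢(ℝ, ℂ)) (f : 𝓢'(ℝ, ℂ)) :
    segmentFun (∑ i ∈ s, ψ i) f = ∑ i ∈ s, segmentFun (ψ i) f := by
  funext x
  simp [segmentFun, translation, FourierTransform.fourier_sum]

theorem segmentFun_smulLeftCLM (ψ χ : 𝓢(ℝ, ℂ)) (f : 𝓢'(ℝ, ℂ)) (x : ℝ) :
    segmentFun (smulLeftCLM ℂ ψ χ) f x = ∫ y, 𝓕⁻ χ (x - y) * segmentFun ψ f y := by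
  rw [segmentFun, fourier_smulLeftCLM, translation_convolution, apply_convolution]
  simp only [translation_apply, fourierInv_eq_fourier_neg, neg_sub, segmentFun]

/-- The norm of `ψ` in `𝓕L¹`; it bounds the Fourier multiplier with symbol `ψ` on every `L^p`. -/
def fourierL1Norm (ψ : 𝓢(ℝ, ℂ)) : ℝ≥0∞ := eLpNorm (𝓕⁻ ψ : 𝓢(ℝ, ℂ)) 1 volume

variable {p : ℝ≥0∞}

theorem eLpNorm_segmentFun_smulLeftCLM_le (hp : 1 ≤ p) (ψ χ : 𝓢(ℝ, ℂ)) (f : 𝓢'(ℝ, ℂ)) :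
    eLpNorm (segmentFun (smulLeftCLM ℂ ψ χ) f) p volume ≤
      fourierL1Norm χ * eLpNorm (segmentFun ψ f) p volume := by
  have hle (x : ℝ) : ‖segmentFun (smulLeftCLM ℂ ψ χ) f x‖ₑ ≤
      ((fun y => ‖𝓕⁻ χ y‖ₑ) ⋆ₗ fun y => ‖segmentFun ψ f y‖ₑ) x := by
    rw [segmentFun_smulLeftCLM, lconvolution_comm, lconvolution_def]
    refine (enorm_integral_le_lintegral_enorm _).trans_eq (lintegral_congr fun y => ?_)
    rw [enorm_mul, mul_comm, neg_add_eq_sub]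
  have hcont := continuous_segmentFun ψ f
  calc eLpNorm (segmentFun (smulLeftCLM ℂ ψ χ) f) p volume
      ≤ eLpNorm ((fun y => ‖𝓕⁻ χ y‖ₑ) ⋆ₗ fun y => ‖segmentFun ψ f y‖ₑ) p volume :=
        eLpNorm_mono_enorm fun x => hle x
    _ ≤ (∫⁻ x, ‖𝓕⁻ χ x‖ₑ) * eLpNorm (fun y => ‖segmentFun ψ f y‖ₑ) p volume :=
        eLpNorm_lconvolution_le (𝓕⁻ χ).continuous.enorm.measurable
          hcont.enorm.measurable hp
    _ = fourierL1Norm χ * eLpNorm (segmentFun ψ f) p volume := by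
        rw [fourierL1Norm, eLpNorm_one_eq_lintegral_enorm, eLpNorm_enorm]

theorem eLpNorm_segmentFun_sum_le (hp : 1 ≤ p) {ι : Type*} (s : Finset ι)
    (ψ : ι → 𝓢(ℝ, ℂ)) (f : 𝓢'(ℝ, ℂ)) :
    eLpNorm (segmentFun (∑ i ∈ s, ψ i) f) p volume ≤
      ∑ i ∈ s, eLpNorm (segmentFun (ψ i) f) p volume := by
  rw [segmentFun_sum]
  exact eLpNorm_sum_le (fun i _ => (continuous_segmentFun _ f).aestronglyMeasurable) hp

theorem eLpNorm_segmentFun_smul (a : ℂ) (ψ : 𝓢(ℝ, ℂ)) (f : 𝓢'(ℝ, ℂ)) :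
    eLpNorm (segmentFun (a • ψ) f) p volume = ‖a‖ₑ * eLpNorm (segmentFun ψ f) p volume := by
  rw [segmentFun_smul, eLpNorm_const_smul]

theorem segmentFun_delta (ψ : 𝓢(ℝ, ℂ)) : segmentFun ψ (TemperedDistribution.delta 0) = 𝓕⁻ ψ := by
  funext x
  simp [segmentFun, translation_apply, fourierInv_eq_fourier_neg]

theorem fourierL1Norm_smulLeftCLM_le (χ ψ : 𝓢(ℝ, ℂ)) :
    fourierL1Norm (smulLeftCLM ℂ χ ψ) ≤ fourierL1Norm ψ * fourierL1Norm χ := by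
  simpa only [fourierL1Norm, segmentFun_delta] using
    eLpNorm_segmentFun_smulLeftCLM_le le_rfl χ ψ (TemperedDistribution.delta 0)

theorem fourierL1Norm_smul (a : ℂ) (ψ : 𝓢(ℝ, ℂ)) :
    fourierL1Norm (a • ψ) = ‖a‖ₑ * fourierL1Norm ψ := by
  rw [fourierL1Norm, FourierTransform.fourierInv_smul]
  exact eLpNorm_const_smul _ _ _ _

theorem fourierL1Norm_lt_top (ψ : 𝓢(ℝ, ℂ)) : fourierL1Norm ψ < ∞ :=
  ((𝓕⁻ ψ).memLp 1 volume).2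

end Segments

section Symbols

/-- The window `ξ ↦ χ ((ξ - b) / h)` with centre `b` and width `h`; the factor undoes
the `L²` normalization of `dilation`. -/
def rescale (b h : ℝ) (hh : 0 < h) (χ : 𝓢(ℝ, ℂ)) : 𝓢(ℝ, ℂ) :=
  ((h ^ (1 / 2 : ℝ) : ℝ) : ℂ) • translation b (dilation h hh χ)

theorem rescale_apply (b h : ℝ) (hh : 0 < h) (χ : 𝓢(ℝ, ℂ)) (ξ : ℝ) :
    rescale b h hh χ ξ = χ ((ξ - b) / h) := by
  have hcancel : h ^ (1 / 2 : ℝ) * h ^ (-(1 / 2) : ℝ) = 1 := by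
    rw [← Real.rpow_add hh, add_neg_cancel, Real.rpow_zero]
  rw [rescale, smul_apply, translation_apply, dilation_apply, smul_eq_mul, ← mul_assoc,
    ← Complex.ofReal_mul, hcancel, Complex.ofReal_one, one_mul]

theorem fourierInv_rescale (b h : ℝ) (hh : 0 < h) (χ : 𝓢(ℝ, ℂ)) (t : ℝ) :
    𝓕⁻ (rescale b h hh χ) t = h * Complex.exp (2 * Real.pi * Complex.I * b * t) * 𝓕⁻ χ (h * t) := by
  have hphase (s : ℝ) : Complex.exp (↑(2 * Real.pi * (t * (s + b))) * Complex.I) =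
      Complex.exp (2 * Real.pi * Complex.I * b * t) *
        Complex.exp (↑(2 * Real.pi * (h * t * (s / h))) * Complex.I) := by
    rw [← Complex.exp_add, mul_right_comm h, mul_div_cancel₀ s hh.ne']
    push_cast
    ring_nf
  simp only [fourierInv_coe, Real.fourierInv_eq', rescale_apply, smul_eq_mul, RCLike.inner_apply,
    conj_trivial]
  rw [← integral_add_right_eq_self _ b]
  calc ∫ s, Complex.exp (↑(2 * Real.pi * (t * (s + b))) * Complex.I) * χ ((s + b - b) / h)
      = ∫ s, Complex.exp (2 * Real.pi * Complex.I * b * t) *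
          (Complex.exp (↑(2 * Real.pi * (h * t * (s / h))) * Complex.I) * χ (s / h)) := by
        refine integral_congr_ae (.of_forall fun s => ?_)
        simp only [hphase, add_sub_cancel_right]
        ring
    _ = _ := by
        rw [integral_const_mul, Measure.integral_comp_div (fun u : ℝ =>
          Complex.exp (↑(2 * Real.pi * (h * t * u)) * Complex.I) * χ u), abs_of_pos hh,
          Complex.real_smul]
        ring

theorem norm_exp_two_pi_I_mul (b t : ℝ) :
    ‖Complex.exp (2 * Real.pi * Complex.I * b * t)‖ = 1 := by
  simp [Complex.norm_exp]

theorem fourierL1Norm_rescale (b h : ℝ) (hh : 0 < h) (χ : 𝓢(ℝ, ℂ)) :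
    fourierL1Norm (rescale b h hh χ) = fourierL1Norm χ := by
  rw [fourierL1Norm, fourierL1Norm, eLpNorm_one_eq_lintegral_enorm,
    eLpNorm_one_eq_lintegral_enorm, ← ofReal_integral_norm_eq_lintegral_enorm (integrable _),
    ← ofReal_integral_norm_eq_lintegral_enorm (integrable _)]
  simp only [fourierInv_rescale, norm_mul, norm_exp_two_pi_I_mul, mul_one, Complex.norm_real,
    Real.norm_of_nonneg hh.le]
  rw [integral_const_mul, Measure.integral_comp_mul_left (fun t => ‖𝓕⁻ χ t‖), smul_eq_mul,
    abs_of_pos (inv_pos.2 hh), mul_inv_cancel_left₀ hh.ne']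

theorem fourier_conjSchwartz (H : 𝓢(ℝ, ℂ)) : 𝓕 (conjSchwartz H) = conjSchwartz (𝓕⁻ H) := by
  ext ξ
  rw [conjSchwartz_apply, fourier_coe, fourierInv_coe, Real.fourier_eq', Real.fourierInv_eq',
    ← integral_conj]
  simp [conjSchwartz_apply, ← Complex.exp_conj, Complex.conj_ofNat]

/-- The symbol of the Fourier multiplier `f ↦ V_g^α f (·, ω)`, namely the multiple `a ^ (1 / 2)` of
`ξ ↦ conj (𝓕 g (a * (ξ - ω)))` with `a = c * (1 + |ω|) ^ (-α)`. -/
def atomSymbol (α c : ℝ) (hc : 0 < c) (g : 𝓢(ℝ, ℂ)) (ω : ℝ) : 𝓢(ℝ, ℂ) :=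
  (((c * (1 + |ω|) ^ (-α)) ^ (1 / 2 : ℝ) : ℝ) : ℂ) •
    rescale ω (c * (1 + |ω|) ^ (-α))⁻¹ (inv_pos.2 (scale_pos hc α ω)) (conjSchwartz (𝓕 g))

theorem sqrt_scale {c : ℝ} (hc : 0 < c) (α ω : ℝ) :
    (c * (1 + |ω|) ^ (-α)) ^ (1 / 2 : ℝ) = c ^ (1 / 2 : ℝ) * (1 + |ω|) ^ (-α / 2) := by
  rw [Real.mul_rpow hc.le (by positivity), ← Real.rpow_mul (by positivity), mul_one_div]

variable (α c : ℝ) (hc : 0 < c) (g : 𝓢(ℝ, ℂ))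

theorem fourier_atomSymbol (ω : ℝ) :
    𝓕 (atomSymbol α c hc g ω) =
      conjSchwartz (modulation ω (dilation (c * (1 + |ω|) ^ (-α)) (scale_pos hc α ω) g)) := by
  have ha := scale_pos hc α ω
  rw [atomSymbol]
  set a := c * (1 + |ω|) ^ (-α)
  have hroot : a ^ (1 / 2 : ℝ) * a⁻¹ = a ^ (-(1 / 2) : ℝ) := by
    rw [← Real.rpow_neg_one a, ← Real.rpow_add ha]
    norm_num
  have hconj (t : ℝ) : 𝓕⁻ (conjSchwartz (𝓕 g)) (-t) = conj (g t) := by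
    rw [fourierInv_eq_fourier_neg, neg_neg, fourier_conjSchwartz,
      FourierTransform.fourierInv_fourier_eq, conjSchwartz_apply]
  ext t
  rw [← neg_neg t, ← fourierInv_eq_fourier_neg, FourierTransform.fourierInv_smul, smul_apply,
    fourierInv_rescale, neg_neg, mul_neg, hconj, conjSchwartz_apply, modulation_apply,
    dilation_apply, ← hroot, smul_eq_mul, inv_mul_eq_div]
  simp only [map_mul, ← Complex.exp_conj, Complex.conj_ofReal, Complex.conj_I, Complex.conj_ofNat,
    Complex.ofReal_neg, Complex.ofReal_mul, mul_neg, neg_mul]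
  ring

theorem alphaTransform_eq_segmentFun (f : 𝓢'(ℝ, ℂ)) (x ω : ℝ) :
    alphaTransform α c hc g f (x, ω) = segmentFun (atomSymbol α c hc g ω) f x := by
  rw [segmentFun, fourier_atomSymbol]
  rfl

theorem atomSymbol_apply (ω ξ : ℝ) :
    atomSymbol α c hc g ω ξ = (((c * (1 + |ω|) ^ (-α)) ^ (1 / 2 : ℝ) : ℝ) : ℂ) *
      conj (𝓕 g (c * (1 + |ω|) ^ (-α) * (ξ - ω))) := by
  rw [atomSymbol, smul_apply, rescale_apply, conjSchwartz_apply, div_inv_eq_mul, smul_eq_mul,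
    mul_comm (ξ - ω)]

end Symbols

section Cutoffs

theorem exists_schwartz_cutoff {r R : ℝ} (hr : 0 < r) (hR : r < R) :
    ∃ η : 𝓢(ℝ, ℂ), (∀ ξ, |ξ| ≤ r → η ξ = 1) ∧ ∀ ξ, R ≤ |ξ| → η ξ = 0 := by
  let b : ContDiffBump (0 : ℝ) := ⟨r, R, hr, hR⟩
  refine ⟨HasCompactSupport.toSchwartzMap (f := fun ξ => (b ξ : ℂ))
    (b.hasCompactSupport.comp_left Complex.ofReal_zero)
    (Complex.ofRealCLM.contDiff.comp b.contDiff), fun ξ hξ => ?_, fun ξ hξ => ?_⟩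
  · exact congrArg Complex.ofReal (b.one_of_mem_closedBall (by simpa using hξ))
  · exact congrArg Complex.ofReal (b.zero_of_le_dist (by simpa using hξ))

theorem exists_schwartz_mul_eq_one {φ : 𝓢(ℝ, ℂ)} (hφ : φ 0 ≠ 0) :
    ∃ η : 𝓢(ℝ, ℂ), ∃ ρ > 0, ∀ ξ, |ξ| ≤ ρ → η ξ * φ ξ = 1 := by
  obtain ⟨ε, hε, hball⟩ := Metric.nhds_basis_closedBall.eventually_iff.1
    (φ.continuous.continuousAt.eventually_ne hφ)
  obtain ⟨b, hb_one, hb_zero⟩ := exists_schwartz_cutoff (half_pos hε) (half_lt_self hε)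
  have hb_tsupport : tsupport (fun ξ => b ξ * (φ ξ)⁻¹) ⊆ Metric.closedBall 0 ε := by
    refine closure_minimal (fun ξ hξ => ?_) Metric.isClosed_closedBall
    by_contra hball
    rw [mem_closedBall_zero_iff, not_le] at hball
    exact hξ (by simp [hb_zero ξ hball.le])
  have hsmooth : ContDiff ℝ (⊤ : ℕ∞) (fun ξ => b ξ * (φ ξ)⁻¹) := by
    refine contDiff_iff_contDiffAt.2 fun ξ => ?_
    by_cases hξ : ξ ∈ tsupport (fun ξ => b ξ * (φ ξ)⁻¹)
    · exact (b.smooth ⊤).contDiffAt.mul ((φ.smooth ⊤).contDiffAt.inv (hball (hb_tsupport hξ)))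
    · exact contDiffAt_const.congr_of_eventuallyEq (notMem_tsupport_iff_eventuallyEq.1 hξ)
  refine ⟨(HasCompactSupport.of_support_subset_isCompact (isCompact_closedBall _ _)
    (subset_closure.trans hb_tsupport)).toSchwartzMap hsmooth, ε / 2, half_pos hε, fun ξ hξ => ?_⟩
  change b ξ * (φ ξ)⁻¹ * φ ξ = 1
  rw [hb_one ξ hξ, one_mul, inv_mul_cancel₀ (hball _)]
  simpa using hξ.trans (half_le_self hε.le)

end Cutoffs

section SymbolBounds

variable {α c : ℝ} {hc : 0 < c} {g : 𝓢(ℝ, ℂ)}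

theorem enorm_rpow_half_scale (α ω : ℝ) (hc : 0 < c) :
    ‖(((c * (1 + |ω|) ^ (-α)) ^ (1 / 2 : ℝ) : ℝ) : ℂ)‖ₑ =
      ENNReal.ofReal (c ^ (1 / 2 : ℝ)) * ENNReal.ofReal ((1 + |ω|) ^ (-α / 2)) := by
  rw [← ofReal_norm, Complex.norm_real, Real.norm_of_nonneg (by positivity), sqrt_scale hc,
    ENNReal.ofReal_mul (by positivity)]

theorem fourierL1Norm_atomSymbol (ω : ℝ) :
    fourierL1Norm (atomSymbol α c hc g ω) = ENNReal.ofReal (c ^ (1 / 2 : ℝ)) *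
      ENNReal.ofReal ((1 + |ω|) ^ (-α / 2)) * fourierL1Norm (conjSchwartz (𝓕 g)) := by
  rw [atomSymbol, fourierL1Norm_smul, fourierL1Norm_rescale, enorm_rpow_half_scale α ω hc]

theorem abs_scale_mul (hc : 0 < c) (α ω t : ℝ) :
    |c * (1 + |ω|) ^ (-α) * t| = |t| / (1 + |ω|) ^ α * c := by
  rw [abs_mul, abs_of_pos (scale_pos hc α ω), Real.rpow_neg (by positivity)]
  ring

theorem atomSymbol_eq_zero {κ : ℝ} (hκ : ∀ ξ : ℝ, κ * c ≤ |ξ| → 𝓕 g ξ = 0) {ω ξ : ℝ}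
    (hξ : κ * (1 + |ω|) ^ α ≤ |ξ - ω|) : atomSymbol α c hc g ω ξ = 0 := by
  rw [atomSymbol_apply, hκ, map_zero, mul_zero]
  rw [abs_scale_mul hc]
  gcongr
  rwa [le_div_iff₀ (by positivity)]

theorem exists_lt_one_atomSymbol_eq_zero (hg : tsupport (𝓕 g : 𝓢(ℝ, ℂ)) ⊆ Metric.ball 0 c) :
    ∃ κ : ℝ, 0 ≤ κ ∧ κ < 1 ∧
      ∀ ω ξ, κ * (1 + |ω|) ^ α ≤ |ξ - ω| → atomSymbol α c hc g ω ξ = 0 := by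
  obtain ⟨r, ⟨hr0, hrc⟩, hr⟩ := exists_pos_lt_subset_ball hc (isClosed_tsupport _) hg
  refine ⟨r / c, by positivity, (div_lt_one hc).2 hrc, fun ω ξ => atomSymbol_eq_zero fun t ht => ?_⟩
  rw [div_mul_cancel₀ _ hc.ne'] at ht
  exact image_eq_zero_of_notMem_tsupport fun hmem => ht.not_gt (by simpa using hr hmem)

theorem eLpNorm_segmentFun_le_atomSymbol {p : ℝ≥0∞} (hp : 1 ≤ p) {η φ : 𝓢(ℝ, ℂ)} {r x : ℝ}
    (hη : ∀ ξ, |ξ| ≤ r * c → η ξ * conj (𝓕 g ξ) = 1)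
    (hφ : ∀ ξ, φ ξ ≠ 0 → |ξ - x| ≤ r * (1 + |x|) ^ α) (f : 𝓢'(ℝ, ℂ)) :
    eLpNorm (segmentFun φ f) p volume ≤
      ENNReal.ofReal (c ^ (-1 / 2 : ℝ)) * ENNReal.ofReal ((1 + |x|) ^ (α / 2)) *
        (fourierL1Norm φ * (fourierL1Norm η *
          eLpNorm (segmentFun (atomSymbol α c hc g x) f) p volume)) := by
  set a := c * (1 + |x|) ^ (-α) with ha
  have ha0 : 0 < a := scale_pos hc α x
  have hroot : ((a ^ (1 / 2 : ℝ) : ℝ) : ℂ) ≠ 0 := Complex.ofReal_ne_zero.2 (by positivity)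
  have hfactor : φ = ((a ^ (1 / 2 : ℝ) : ℝ) : ℂ)⁻¹ • smulLeftCLM ℂ (smulLeftCLM ℂ
      (atomSymbol α c hc g x) (rescale x a⁻¹ (inv_pos.2 ha0) η)) φ := by
    ext ξ
    simp only [smul_apply, smulLeftCLM_schwartz_apply, atomSymbol_apply, rescale_apply, smul_eq_mul,
      div_inv_eq_mul, ← ha]
    by_cases hξ : φ ξ = 0
    · rw [hξ, mul_zero, mul_zero]
    · have hone := hη (a * (ξ - x)) (by
        rw [abs_scale_mul hc]
        gcongr
        exact (div_le_iff₀ (by positivity)).2 (hφ ξ hξ))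
      rw [mul_comm (ξ - x), mul_assoc _ _ (η _), mul_comm _ (η _), hone, mul_one,
        inv_mul_cancel_left₀ hroot]
  have hnorm : ‖((a ^ (1 / 2 : ℝ) : ℝ) : ℂ)⁻¹‖ₑ =
      ENNReal.ofReal (c ^ (-1 / 2 : ℝ)) * ENNReal.ofReal ((1 + |x|) ^ (α / 2)) := by
    rw [enorm_inv hroot, enorm_rpow_half_scale α x hc,
      ENNReal.mul_inv (by simp) (by simp), ← ENNReal.ofReal_inv_of_pos (by positivity),
      ← ENNReal.ofReal_inv_of_pos (by positivity), ← Real.rpow_neg hc.le,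
      ← Real.rpow_neg (by positivity), neg_div, neg_div, neg_neg]
  calc eLpNorm (segmentFun φ f) p volume
      = ‖((a ^ (1 / 2 : ℝ) : ℝ) : ℂ)⁻¹‖ₑ * eLpNorm (segmentFun (smulLeftCLM ℂ (smulLeftCLM ℂ
          (atomSymbol α c hc g x) (rescale x a⁻¹ (inv_pos.2 ha0) η)) φ) f) p volume := by
        rw [← eLpNorm_segmentFun_smul, ← hfactor]
    _ ≤ _ := by
        rw [hnorm, ← fourierL1Norm_rescale x a⁻¹ (inv_pos.2 ha0) η]
        gcongr
        refine (eLpNorm_segmentFun_smulLeftCLM_le hp _ _ f).trans ?_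
        gcongr
        exact eLpNorm_segmentFun_smulLeftCLM_le hp _ _ f

end SymbolBounds

section Partition

theorem exists_schwartz_translation_partition :
    ∃ χ : 𝓢(ℝ, ℂ), (∀ ξ, 1 ≤ |ξ| → χ ξ = 0) ∧ ∀ (M : ℕ) (t : ℝ), |t| ≤ M →
      ∑ j ∈ Finset.range (2 * M + 1), χ (t - ((j : ℝ) - M)) = 1 := by
  obtain ⟨S, hS_zero, hS_one, hS_smooth⟩ : ∃ S : ℝ → ℝ, (∀ x ≤ 0, S x = 0) ∧
      (∀ x, 1 ≤ x → S x = 1) ∧ ContDiff ℝ (⊤ : ℕ∞) S :=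
    ⟨Real.smoothTransition, fun _ => Real.smoothTransition.zero_of_nonpos,
      fun _ => Real.smoothTransition.one_of_one_le, Real.smoothTransition.contDiff⟩
  have hzero (ξ : ℝ) (hξ : 1 ≤ |ξ|) : S (ξ + 1) - S ξ = 0 := by
    rcases le_abs.1 hξ with h | h
    · rw [hS_one _ (by linarith), hS_one _ h, sub_self]
    · rw [hS_zero _ (by linarith), hS_zero _ (by linarith), sub_self]
  have hsupp : HasCompactSupport fun ξ : ℝ => ((S (ξ + 1) - S ξ : ℝ) : ℂ) := by
    refine HasCompactSupport.intro (isCompact_closedBall (0 : ℝ) 1) fun ξ hξ => ?_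
    rw [mem_closedBall_zero_iff, not_le] at hξ
    rw [hzero ξ hξ.le, Complex.ofReal_zero]
  have hsmooth : ContDiff ℝ (⊤ : ℕ∞) fun ξ : ℝ => ((S (ξ + 1) - S ξ : ℝ) : ℂ) :=
    Complex.ofRealCLM.contDiff.comp
      ((hS_smooth.comp (contDiff_id.add contDiff_const)).sub hS_smooth)
  have htelescope (M : ℕ) (t : ℝ) : ∑ j ∈ Finset.range (2 * M + 1),
      (S (t - ((j : ℝ) - M) + 1) - S (t - ((j : ℝ) - M))) = S (t + M + 1) - S (t - M) := by
    calc _ = ∑ j ∈ Finset.range (2 * M + 1), (S (t + M + 1 - (j : ℕ)) -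
          S (t + M + 1 - (j + 1 : ℕ))) := by
          refine Finset.sum_congr rfl fun j _ => ?_
          congr 2 <;> push_cast <;> ring
      _ = S (t + M + 1 - (0 : ℕ)) - S (t + M + 1 - (2 * M + 1 : ℕ)) :=
          Finset.sum_range_sub' (fun j : ℕ => S (t + M + 1 - j)) _
      _ = S (t + M + 1) - S (t - M) := by
          congr 2 <;> push_cast <;> ring
  refine ⟨hsupp.toSchwartzMap hsmooth, fun ξ hξ => ?_, fun M t ht => ?_⟩
  · exact congrArg Complex.ofReal (hzero ξ hξ)
  · change ∑ j ∈ Finset.range (2 * M + 1),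
      ((S (t - ((j : ℝ) - M) + 1) - S (t - ((j : ℝ) - M)) : ℝ) : ℂ) = 1
    obtain ⟨hlower, hupper⟩ := abs_le.1 ht
    rw [← Complex.ofReal_sum, htelescope, hS_one _ (by linarith), hS_zero _ (by linarith),
      sub_zero, Complex.ofReal_one]

end Partition

section Measurability

theorem segmentFun_eq_integral {ψ η : 𝓢(ℝ, ℂ)} (h : ∀ ξ, ψ ξ ≠ 0 → η ξ = 1) (f : 𝓢'(ℝ, ℂ))
    (x : ℝ) : segmentFun ψ f x = ∫ y, 𝓕⁻ ψ (x - y) * segmentFun η f y := by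
  have hmul : smulLeftCLM ℂ η ψ = ψ := by
    ext ξ
    rw [smulLeftCLM_schwartz_apply]
    by_cases hξ : ψ ξ = 0
    · rw [hξ, mul_zero]
    · rw [h ξ hξ, one_mul]
  rw [← segmentFun_smulLeftCLM, hmul]

variable (α c : ℝ) (hc : 0 < c) (g : 𝓢(ℝ, ℂ))

theorem continuous_fourierInv_atomSymbol :
    Continuous fun z : ℝ × ℝ => 𝓕⁻ (atomSymbol α c hc g z.1) z.2 := by
  simp only [fourierInv_eq_fourier_neg, fourier_atomSymbol, conjSchwartz_apply, modulation_apply,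
    dilation_apply]
  have hscale : Continuous fun z : ℝ × ℝ => c * (1 + |z.1|) ^ (-α) :=
    continuous_const.mul (Continuous.rpow_const (by fun_prop) fun z => Or.inl (by positivity))
  have hscale_rpow : Continuous fun z : ℝ × ℝ => (c * (1 + |z.1|) ^ (-α)) ^ (-(1 / 2) : ℝ) :=
    hscale.rpow_const fun z => Or.inl (scale_pos hc α z.1).ne'
  have harg : Continuous fun z : ℝ × ℝ => -z.2 / (c * (1 + |z.1|) ^ (-α)) :=
    Continuous.div (by fun_prop) hscale fun z => (scale_pos hc α z.1).ne'
  have := g.continuous.comp harg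
  exact Complex.continuous_conj.comp (by fun_prop)

variable {g} in
theorem exists_atomSymbol_eq_zero (hg : IsBandLimited g) (ω : ℝ) :
    ∃ R : ℝ, ∀ ξ, R ≤ |ξ| → atomSymbol α c hc g ω ξ = 0 := by
  obtain ⟨r, hr⟩ := hg.isBounded.subset_closedBall 0
  refine ⟨(r + 1) / c * (1 + |ω|) ^ α + |ω|, fun ξ hξ => ?_⟩
  refine atomSymbol_eq_zero (κ := (r + 1) / c) (fun t ht => ?_) ?_
  · rw [div_mul_cancel₀ _ hc.ne'] at ht
    refine image_eq_zero_of_notMem_tsupport fun hmem => ?_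
    have : |t| ≤ r := by simpa using hr hmem
    linarith
  · linarith [abs_sub_abs_le_abs_sub ξ ω]

variable {g} in
/- Restricting to frequencies below `n` turns `f` into a function, so that the transform is a
parametric integral; for fixed `ω` the restriction has no effect once `n` is large. -/
theorem stronglyMeasurable_alphaTransform (hg : IsBandLimited g) (f : 𝓢'(ℝ, ℂ)) :
    StronglyMeasurable (alphaTransform α c hc g f) := by
  have hcutoff (n : ℕ) : ∃ η : 𝓢(ℝ, ℂ), ∀ ξ : ℝ, |ξ| ≤ n + 1 → η ξ = 1 :=
    (exists_schwartz_cutoff n.cast_add_one_pos (lt_add_one _)).imp fun η h => h.1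
  choose η hη using hcutoff
  let u (n : ℕ) (z : ℝ × ℝ) : ℂ :=
    ∫ y, 𝓕⁻ (atomSymbol α c hc g z.2) (z.1 - y) * segmentFun (η n) f y
  have hu (n : ℕ) : StronglyMeasurable (u n) := by
    have hsegment := continuous_segmentFun (η n) f
    have hatom : Continuous fun w : (ℝ × ℝ) × ℝ =>
        𝓕⁻ (atomSymbol α c hc g w.1.2) (w.1.1 - w.2) :=
      (continuous_fourierInv_atomSymbol α c hc g).comp
        (f := fun w : (ℝ × ℝ) × ℝ => (w.1.2, w.1.1 - w.2)) (by fun_prop)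
    exact (hatom.mul (hsegment.comp continuous_snd)).stronglyMeasurable.integral_prod_right'
  refine stronglyMeasurable_of_tendsto Filter.atTop hu (tendsto_pi_nhds.2 fun z => ?_)
  obtain ⟨R, hR⟩ := exists_atomSymbol_eq_zero α c hc hg z.2
  obtain ⟨N, hN⟩ := exists_nat_ge R
  refine tendsto_const_nhds.congr' ?_
  filter_upwards [Filter.eventually_ge_atTop N] with n hn
  rw [← Prod.eta z, alphaTransform_eq_segmentFun]
  refine segmentFun_eq_integral (fun ξ hξ => hη n ξ ?_) f z.1
  contrapose! hξ
  have : (N : ℝ) ≤ n := by exact_mod_cast hn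
  exact hR ξ (by linarith)

end Measurability

section Overlap

variable {X ι : Type*} [MeasurableSpace X] {μ : Measure X} {J : ι → Set X}

theorem sum_restrict_le_of_encard_le [Countable ι] (hJ : ∀ i, MeasurableSet (J i)) {N : ℕ}
    (hN : ∀ x, {i | x ∈ J i}.encard ≤ N) :
    Measure.sum (fun i => μ.restrict (J i)) ≤ (N : ℝ≥0∞) • μ := by
  refine Measure.le_iff.2 fun E hE => ?_
  calc Measure.sum (fun i => μ.restrict (J i)) E
      = ∑' i, ∫⁻ x in E, (J i).indicator 1 x ∂μ := by
        rw [Measure.sum_apply _ hE]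
        refine tsum_congr fun i => ?_
        rw [lintegral_indicator_one (hJ i), Measure.restrict_apply hE,
          Measure.restrict_apply (hJ i), Set.inter_comm]
    _ = ∫⁻ x in E, ∑' i, (J i).indicator 1 x ∂μ :=
        (lintegral_tsum fun i => (measurable_one.indicator (hJ i)).aemeasurable).symm
    _ ≤ ∫⁻ _ in E, N ∂μ := by
        refine lintegral_mono fun x => ?_
        calc ∑' i, (J i).indicator (1 : X → ℝ≥0∞) x
            = ∑' i, {i | x ∈ J i}.indicator (fun _ => (1 : ℝ≥0∞)) i := rfl
          _ = ({i | x ∈ J i}.encard : ℝ≥0∞) := by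
              rw [← tsum_subtype, ENNReal.tsum_set_one]
          _ ≤ N := by exact_mod_cast hN x
    _ = ((N : ℝ≥0∞) • μ) E := by rw [setLIntegral_const]; rfl

theorem tsum_setLIntegral_le_of_encard_le [Countable ι] (hJ : ∀ i, MeasurableSet (J i)) {N : ℕ}
    (hN : ∀ x, {i | x ∈ J i}.encard ≤ N) (W : X → ℝ≥0∞) :
    ∑' i, ∫⁻ x in J i, W x ∂μ ≤ N * ∫⁻ x, W x ∂μ := by
  rw [← lintegral_sum_measure, ← smul_eq_mul, ← lintegral_smul_measure]
  exact lintegral_mono' (sum_restrict_le_of_encard_le hJ hN) le_rfl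

end Overlap

section SequenceNorm

variable {X ι : Type*} [MeasurableSpace X] {μ : Measure X} {J : ι → Set X} {W : X → ℝ≥0∞}
  {γ h : ι → ℝ≥0∞} {C D : ℝ≥0∞}

theorem mul_rpow_inv_rpow {r : ℝ} (hr : 0 < r) (a b : ℝ≥0∞) :
    (a * b ^ r⁻¹) ^ r = a ^ r * b := by
  rw [ENNReal.mul_rpow_of_nonneg _ _ hr.le, ENNReal.rpow_inv_rpow hr.ne']

theorem lintegral_rpow_le_tsum [Countable ι] {r : ℝ} (hr : 0 < r)
    (hJ : ∀ i, MeasurableSet (J i)) (hvol : ∀ i, μ (J i) ≤ D * h i)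
    (hW : ∀ x, ∃ i, x ∈ J i ∧ W x ≤ C * γ i) :
    ∫⁻ x, W x ^ r ∂μ ≤ C ^ r * D * ∑' i, (γ i * h i ^ r⁻¹) ^ r := by
  calc ∫⁻ x, W x ^ r ∂μ ≤ ∫⁻ x, ∑' i, (J i).indicator (fun _ => (C * γ i) ^ r) x ∂μ := by
        refine lintegral_mono fun x => ?_
        obtain ⟨i, hi, hWi⟩ := hW x
        calc W x ^ r ≤ (C * γ i) ^ r := by gcongr
          _ = (J i).indicator (fun _ => (C * γ i) ^ r) x := by rw [Set.indicator_of_mem hi]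
          _ ≤ _ := ENNReal.le_tsum i
    _ = ∑' i, (C * γ i) ^ r * μ (J i) := by
        rw [lintegral_tsum fun i => (measurable_const.indicator (hJ i)).aemeasurable]
        simp only [lintegral_indicator_const (hJ _)]
    _ ≤ ∑' i, C ^ r * D * (γ i * h i ^ r⁻¹) ^ r := by
        refine ENNReal.tsum_le_tsum fun i => ?_
        calc (C * γ i) ^ r * μ (J i) ≤ (C * γ i) ^ r * (D * h i) := by gcongr; exact hvol i
          _ = C ^ r * D * (γ i * h i ^ r⁻¹) ^ r := by
              rw [ENNReal.mul_rpow_of_nonneg _ _ hr.le, mul_rpow_inv_rpow hr]; ring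
    _ = _ := ENNReal.tsum_mul_left

theorem eLpNorm_le_lqNorm [Countable ι] {q : ℝ≥0∞} (hq : q ≠ 0)
    (hJ : ∀ i, MeasurableSet (J i)) (hvol : ∀ i, μ (J i) ≤ D * h i)
    (hW : ∀ x, ∃ i, x ∈ J i ∧ W x ≤ C * γ i) :
    eLpNorm W q μ ≤ C * D ^ (q⁻¹).toReal * lqNorm q fun i => γ i * h i ^ (q⁻¹).toReal := by
  rcases eq_or_ne q ∞ with rfl | hq'
  · simp only [lqNorm, if_true, ENNReal.inv_top, ENNReal.toReal_zero, ENNReal.rpow_zero, mul_one,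
      eLpNorm_exponent_top]
    refine essSup_le_of_ae_le _ (.of_forall fun x => ?_)
    obtain ⟨i, -, hi⟩ := hW x
    exact hi.trans (mul_le_mul_right (le_iSup γ i) C)
  · have hr : 0 < q.toReal := ENNReal.toReal_pos hq hq'
    have hr' : 0 ≤ q.toReal⁻¹ := inv_nonneg.2 hr.le
    rw [lqNorm, if_neg hq', eLpNorm_eq_lintegral_rpow_enorm_toReal hq hq', ENNReal.toReal_inv,
      one_div]
    simp only [enorm_eq_self]
    refine (ENNReal.rpow_le_rpow (lintegral_rpow_le_tsum hr hJ hvol hW) hr').trans_eq ?_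
    rw [ENNReal.mul_rpow_of_nonneg _ _ hr', ENNReal.mul_rpow_of_nonneg _ _ hr',
      ENNReal.rpow_rpow_inv hr.ne']

theorem iSup_le_mul_eLpNormEssSup (hJ : ∀ i, μ (J i) ≠ 0) (hW : ∀ i, ∀ x ∈ J i, γ i ≤ C * W x) :
    ⨆ i, γ i ≤ C * eLpNormEssSup W μ := by
  refine iSup_le fun i => ?_
  obtain ⟨x, hx, hWx⟩ : ∃ x ∈ J i, W x ≤ eLpNormEssSup W μ := by
    by_contra! hcon
    exact hJ i (measure_mono_null hcon (meas_eLpNormEssSup_lt (f := W)))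
  exact (hW i x hx).trans (by gcongr)

theorem tsum_le_lintegral_rpow [Countable ι] {r : ℝ} (hr : 0 < r) (hC : C ≠ ∞)
    (hJ : ∀ i, MeasurableSet (J i)) (hvol : ∀ i, h i ≤ D * μ (J i))
    (hW : ∀ i, ∀ x ∈ J i, γ i ≤ C * W x) {N : ℕ} (hN : ∀ x, {i | x ∈ J i}.encard ≤ N) :
    ∑' i, (γ i * h i ^ r⁻¹) ^ r ≤ C ^ r * (D * N) * ∫⁻ x, W x ^ r ∂μ := by
  calc ∑' i, (γ i * h i ^ r⁻¹) ^ r ≤ ∑' i, C ^ r * D * ∫⁻ x in J i, W x ^ r ∂μ := by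
        refine ENNReal.tsum_le_tsum fun i => ?_
        calc (γ i * h i ^ r⁻¹) ^ r ≤ γ i ^ r * (D * μ (J i)) := by
              rw [mul_rpow_inv_rpow hr]; gcongr; exact hvol i
          _ = D * ∫⁻ _ in J i, γ i ^ r ∂μ := by rw [setLIntegral_const]; ring
          _ ≤ D * ∫⁻ x in J i, C ^ r * W x ^ r ∂μ := by
              gcongr 1
              refine setLIntegral_mono' (hJ i) fun x hx => ?_
              rw [← ENNReal.mul_rpow_of_nonneg _ _ hr.le]
              exact ENNReal.rpow_le_rpow (hW i x hx) hr.le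
          _ = C ^ r * D * ∫⁻ x in J i, W x ^ r ∂μ := by
              rw [lintegral_const_mul' _ _ (ENNReal.rpow_ne_top_of_nonneg hr.le hC)]; ring
    _ = C ^ r * D * ∑' i, ∫⁻ x in J i, W x ^ r ∂μ := ENNReal.tsum_mul_left
    _ ≤ C ^ r * D * (N * ∫⁻ x, W x ^ r ∂μ) := by
        gcongr; exact tsum_setLIntegral_le_of_encard_le hJ hN _
    _ = _ := by ring

theorem lqNorm_le_eLpNorm [Countable ι] {q : ℝ≥0∞} (hq : q ≠ 0) (hC : C ≠ ∞)
    (hJ : ∀ i, MeasurableSet (J i)) (hpos : ∀ i, μ (J i) ≠ 0) (hvol : ∀ i, h i ≤ D * μ (J i))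
    (hW : ∀ i, ∀ x ∈ J i, γ i ≤ C * W x) {N : ℕ} (hN : ∀ x, {i | x ∈ J i}.encard ≤ N) :
    lqNorm q (fun i => γ i * h i ^ (q⁻¹).toReal) ≤
      C * (D * N) ^ (q⁻¹).toReal * eLpNorm W q μ := by
  rcases eq_or_ne q ∞ with rfl | hq'
  · simp only [lqNorm, if_true, ENNReal.inv_top, ENNReal.toReal_zero, ENNReal.rpow_zero, mul_one,
      eLpNorm_exponent_top]
    exact iSup_le_mul_eLpNormEssSup hpos hW
  · have hr : 0 < q.toReal := ENNReal.toReal_pos hq hq'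
    have hr' : 0 ≤ q.toReal⁻¹ := inv_nonneg.2 hr.le
    rw [lqNorm, if_neg hq', eLpNorm_eq_lintegral_rpow_enorm_toReal hq hq', ENNReal.toReal_inv,
      one_div]
    simp only [enorm_eq_self]
    refine (ENNReal.rpow_le_rpow (tsum_le_lintegral_rpow hr hC hJ hvol hW hN) hr').trans_eq ?_
    rw [ENNReal.mul_rpow_of_nonneg _ _ hr', ENNReal.mul_rpow_of_nonneg _ _ hr',
      ENNReal.rpow_rpow_inv hr.ne']

end SequenceNorm

section Near

/-- Two frequencies are near if their distance is at most `R` times the scale `(1 + |ξ|) ^ α` at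
either of them. This is the relation between frequencies of neighbouring intervals of an
α-covering; asking for the bound at both points makes it symmetric. -/
def Near (α R x y : ℝ) : Prop :=
  |x - y| ≤ R * (1 + |x|) ^ α ∧ |x - y| ≤ R * (1 + |y|) ^ α

theorem rpow_le_rpow_abs_mul_rpow {a b K : ℝ} (ha : 0 < a) (hb : 0 < b) (hK : 0 < K)
    (hab : a ≤ K * b) (hba : b ≤ K * a) (r : ℝ) : a ^ r ≤ K ^ |r| * b ^ r := by
  rcases le_total 0 r with hr | hr
  · rw [abs_of_nonneg hr, ← Real.mul_rpow hK.le hb.le]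
    exact Real.rpow_le_rpow ha.le hab hr
  · rw [abs_of_nonpos hr, Real.rpow_neg hK.le, ← Real.inv_rpow hK.le,
      ← Real.mul_rpow (inv_pos.2 hK).le hb.le]
    exact Real.rpow_le_rpow_of_nonpos (by positivity) ((inv_mul_le_iff₀ hK).2 hba) hr

theorem one_add_abs_rpow_le_self {α : ℝ} (hα : α ≤ 1) (x : ℝ) : (1 + |x|) ^ α ≤ 1 + |x| := by
  simpa using Real.rpow_le_rpow_of_exponent_le (le_add_of_nonneg_right (abs_nonneg x)) hα

theorem one_add_abs_le_of_abs_sub_le {α R x y : ℝ} (hα : α ≤ 1) (hR : 0 ≤ R)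
    (h : |x - y| ≤ R * (1 + |y|) ^ α) : 1 + |x| ≤ (1 + R) * (1 + |y|) := by
  linarith [abs_sub_abs_le_abs_sub x y,
    mul_le_mul_of_nonneg_left (one_add_abs_rpow_le_self hα y) hR]

namespace Near

variable {α R R' x y z : ℝ}

theorem symm (h : Near α R x y) : Near α R y x :=
  ⟨by rw [abs_sub_comm]; exact h.2, by rw [abs_sub_comm]; exact h.1⟩

theorem rpow_le (hα : α ≤ 1) (hR : 0 ≤ R) (h : Near α R x y) (r : ℝ) :
    (1 + |x|) ^ r ≤ (1 + R) ^ |r| * (1 + |y|) ^ r :=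
  rpow_le_rpow_abs_mul_rpow (by positivity) (by positivity) (by positivity)
    (one_add_abs_le_of_abs_sub_le hα hR h.2) (one_add_abs_le_of_abs_sub_le hα hR h.symm.2) r

theorem ofReal_rpow_le (hα : α ≤ 1) (hR : 0 ≤ R) (h : Near α R x y) (r : ℝ) :
    ENNReal.ofReal ((1 + |x|) ^ r) ≤
      ENNReal.ofReal ((1 + R) ^ |r|) * ENNReal.ofReal ((1 + |y|) ^ r) := by
  rw [← ENNReal.ofReal_mul (by positivity)]
  exact ENNReal.ofReal_le_ofReal (h.rpow_le hα hR r)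

theorem trans (hα : α ≤ 1) (hR : 0 ≤ R) (hR' : 0 ≤ R') (h : Near α R x y)
    (h' : Near α R' y z) : Near α (R * (1 + R') ^ |α| + R' * (1 + R) ^ |α|) x z := by
  have htri : |x - z| ≤ |x - y| + |y - z| := abs_sub_le x y z
  have one_le {K : ℝ} (hK : 0 ≤ K) : 1 ≤ (1 + K) ^ |α| :=
    Real.one_le_rpow (by linarith) (abs_nonneg α)
  constructor
  · calc |x - z| ≤ R * 1 * (1 + |x|) ^ α + R' * (1 + |y|) ^ α := by linarith [h.1, h'.1]
      _ ≤ R * (1 + R') ^ |α| * (1 + |x|) ^ α + R' * ((1 + R) ^ |α| * (1 + |x|) ^ α) := by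
          gcongr
          exacts [one_le hR', h.symm.rpow_le hα hR α]
      _ = _ := by ring
  · calc |x - z| ≤ R * (1 + |y|) ^ α + R' * 1 * (1 + |z|) ^ α := by linarith [h.2, h'.2]
      _ ≤ R * ((1 + R') ^ |α| * (1 + |z|) ^ α) + R' * (1 + R) ^ |α| * (1 + |z|) ^ α := by
          gcongr
          exacts [h'.rpow_le hα hR' α, one_le hR]
      _ = _ := by ring

theorem of_abs_sub_le (hα : α ≤ 1) (hR : 0 ≤ R) (hR1 : R < 1)
    (h : |x - y| ≤ R * (1 + |y|) ^ α) : Near α (R * (1 - R)⁻¹ ^ |α|) x y := by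
  have hpos : 0 < 1 - R := sub_pos.2 hR1
  have hxy : 1 + |x| ≤ (1 - R)⁻¹ * (1 + |y|) := by
    refine (one_add_abs_le_of_abs_sub_le hα hR h).trans ?_
    gcongr
    rw [le_inv_comm₀ (by positivity) hpos, inv_eq_one_div, le_div_iff₀ (by positivity)]
    nlinarith
  have hyx : 1 + |y| ≤ (1 - R)⁻¹ * (1 + |x|) := by
    rw [le_inv_mul_iff₀ hpos]
    linarith [abs_sub_abs_le_abs_sub y x, abs_sub_comm x y,
      mul_le_mul_of_nonneg_left (one_add_abs_rpow_le_self hα y) hR]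
  have hone : 1 ≤ (1 - R)⁻¹ ^ |α| :=
    Real.one_le_rpow ((one_le_inv₀ hpos).2 (by linarith)) (abs_nonneg α)
  constructor
  · rw [mul_assoc]
    exact h.trans (mul_le_mul_of_nonneg_left
      (rpow_le_rpow_abs_mul_rpow (by positivity) (by positivity) (inv_pos.2 hpos) hyx hxy α) hR)
  · exact h.trans (by gcongr; exact le_mul_of_one_le_right hR hone)

end Near

theorem measurableSet_near (α R y : ℝ) : MeasurableSet {x | Near α R x y} := by
  have hdist : Measurable fun x : ℝ => |x - y| := by fun_prop
  have hscale : Measurable fun x : ℝ => R * (1 + |x|) ^ α := by fun_prop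
  exact (measurableSet_le hdist hscale).inter (measurableSet_le hdist measurable_const)

theorem volume_near_le (α R y : ℝ) :
    volume {x | Near α R x y} ≤ ENNReal.ofReal (2 * R * (1 + |y|) ^ α) := by
  calc volume {x | Near α R x y} ≤ volume (Metric.closedBall y (R * (1 + |y|) ^ α)) :=
        measure_mono fun x hx => hx.2
    _ = _ := by rw [Real.volume_closedBall, mul_assoc]

end Near

section Covering

theorem ofReal_abs_sub_le_volume {I : Set ℝ} (hI : I.OrdConnected) {x y : ℝ} (hx : x ∈ I)
    (hy : y ∈ I) : ENNReal.ofReal |x - y| ≤ volume I := by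
  rw [abs_sub_comm, ← Real.volume_interval]
  exact measure_mono (hI.uIcc_subset hx hy)

theorem encard_mul_le_of_encard_le {X ι : Type*} [Countable ι] [MeasurableSpace X]
    {μ : Measure X} {J : ι → Set X} (hJ : ∀ i, MeasurableSet (J i)) {K : Set X}
    (hK : MeasurableSet K) {N : ℕ} (hN : ∀ x, {i | x ∈ J i}.encard ≤ N) {s : Set ι} {a : ℝ≥0∞}
    (hsub : ∀ i ∈ s, J i ⊆ K) (ha : ∀ i ∈ s, a ≤ μ (J i)) : s.encard * a ≤ N * μ K := by
  calc s.encard * a = ∑' _ : s, a := (ENNReal.tsum_set_const s a).symm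
    _ ≤ ∑' i : s, μ.restrict (J i) K := ENNReal.tsum_le_tsum fun i => by
        rw [Measure.restrict_apply hK, Set.inter_eq_self_of_subset_right (hsub i i.2)]
        exact ha i i.2
    _ ≤ ∑' i, μ.restrict (J i) K :=
        ENNReal.tsum_comp_le_tsum_of_injective Subtype.val_injective _
    _ = Measure.sum (fun i => μ.restrict (J i)) K := (Measure.sum_apply _ hK).symm
    _ ≤ ((N : ℝ≥0∞) • μ) K := sum_restrict_le_of_encard_le hJ hN K

variable {α : ℝ} {𝓘 : Set (Set ℝ)}

theorem IsAlphaCovering.exists_near (h𝓘 : IsAlphaCovering α 𝓘) :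
    ∃ B, 0 ≤ B ∧ ∀ I ∈ 𝓘, ∀ x ∈ I, ∀ y ∈ I, Near α B x y := by
  obtain ⟨A, B, -, hB, hsize⟩ := h𝓘.size
  refine ⟨B, hB.le, fun I hI x hx y hy => ?_⟩
  have h := ofReal_abs_sub_le_volume (h𝓘.interval I hI) hx hy
  exact ⟨(ENNReal.ofReal_le_ofReal_iff (by positivity)).1 (h.trans (hsize I hI x hx).2),
    (ENNReal.ofReal_le_ofReal_iff (by positivity)).1 (h.trans (hsize I hI y hy).2)⟩

theorem IsAlphaCovering.encard_subtype_le (h𝓘 : IsAlphaCovering α 𝓘) (x : ℝ) :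
    {I : 𝓘 | x ∈ (I : Set ℝ)}.encard ≤ 2 := by
  rw [← Subtype.val_injective.encard_image]
  refine (Set.encard_le_encard ?_).trans (h𝓘.overlap x)
  rintro - ⟨I, hI, rfl⟩
  exact ⟨I.2, hI⟩

theorem IsAlphaCovering.exists_subset_closedBall (hα : α ≤ 1) (h𝓘 : IsAlphaCovering α 𝓘) {R : ℝ}
    (hR : 0 ≤ R) : ∃ R', ∀ I ∈ 𝓘, ∀ ξ ∈ I, ∀ x, Near α R x ξ →
      I ⊆ Metric.closedBall x (R' * (1 + |x|) ^ α) := by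
  obtain ⟨B, hB, hnear⟩ := h𝓘.exists_near
  refine ⟨R * (1 + B) ^ |α| + B * (1 + R) ^ |α|, fun I hI ξ hξ x hx y hy => ?_⟩
  rw [Metric.mem_closedBall, Real.dist_eq, abs_sub_comm]
  exact (hx.trans hα hR hB (hnear I hI ξ hξ y hy)).1

theorem IsAlphaCovering.exists_le_volume (hα : α ≤ 1) (h𝓘 : IsAlphaCovering α 𝓘) {R : ℝ}
    (hR : 0 ≤ R) : ∃ A, 0 < A ∧ ∀ I ∈ 𝓘, ∀ ξ ∈ I, ∀ x, Near α R x ξ →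
      ENNReal.ofReal (A * (1 + |x|) ^ α) ≤ volume I := by
  obtain ⟨A, _, hA, -, hsize⟩ := h𝓘.size
  refine ⟨A / (1 + R) ^ |α|, by positivity, fun I hI ξ hξ x hx => ?_⟩
  refine (ENNReal.ofReal_le_ofReal ?_).trans (hsize I hI ξ hξ).1
  rw [div_mul_eq_mul_div, div_le_iff₀ (by positivity), mul_assoc, mul_comm (_ ^ α)]
  gcongr
  exact hx.rpow_le hα hR α

theorem IsAlphaCovering.exists_encard_near_le (hα : α ≤ 1) (h𝓘 : IsAlphaCovering α 𝓘)
    {ω : 𝓘 → ℝ} (hω : ∀ I : 𝓘, ω I ∈ (I : Set ℝ)) {R : ℝ} (hR : 0 ≤ R) :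
    ∃ N : ℕ, ∀ x, {I : 𝓘 | Near α R x (ω I)}.encard ≤ N := by
  obtain ⟨A, hA, hlower⟩ := h𝓘.exists_le_volume hα hR
  obtain ⟨R', hsub⟩ := h𝓘.exists_subset_closedBall hα hR
  have : Countable 𝓘 := h𝓘.countable
  obtain ⟨N, hN⟩ := exists_nat_ge (4 * R' / A)
  rw [div_le_iff₀ hA] at hN
  refine ⟨N, fun x => ?_⟩
  set h := (1 + |x|) ^ α
  have hh : 0 < h := by positivity
  have hcount := encard_mul_le_of_encard_le (fun I : 𝓘 => (h𝓘.interval I I.2).measurableSet)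
    Metric.isClosed_closedBall.measurableSet (N := 2) h𝓘.encard_subtype_le
    (fun I hI => hsub I I.2 _ (hω I) x hI) (fun I hI => hlower I I.2 _ (hω I) x hI)
  have hball : ((2 : ℕ) : ℝ≥0∞) * volume (Metric.closedBall x (R' * h)) ≤
      N * ENNReal.ofReal (A * h) := by
    rw [Real.volume_closedBall, ← ENNReal.ofReal_natCast, ← ENNReal.ofReal_natCast,
      ← ENNReal.ofReal_mul (by positivity), ← ENNReal.ofReal_mul (by positivity)]
    refine ENNReal.ofReal_le_ofReal ?_
    push_cast
    linarith [mul_le_mul_of_nonneg_right hN hh.le]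
  have hpos : ENNReal.ofReal (A * h) ≠ 0 := (ENNReal.ofReal_pos.2 (by positivity)).ne'
  exact_mod_cast (ENNReal.mul_le_mul_iff_left hpos ENNReal.ofReal_ne_top).1 (hcount.trans hball)

end Covering

section Localization

variable {p : ℝ≥0∞}

theorem exists_mem_eLpNorm_segmentFun_sum_le (hp : 1 ≤ p) {ι : Type*} {s : Finset ι}
    (hs : s.Nonempty) (φ : ι → 𝓢(ℝ, ℂ)) (f : 𝓢'(ℝ, ℂ)) :
    ∃ i ∈ s, eLpNorm (segmentFun (∑ i ∈ s, φ i) f) p volume ≤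
      s.card * eLpNorm (segmentFun (φ i) f) p volume := by
  obtain ⟨i, hi, hmax⟩ := s.exists_max_image (fun i => eLpNorm (segmentFun (φ i) f) p volume) hs
  refine ⟨i, hi, (eLpNorm_segmentFun_sum_le hp s φ f).trans ?_⟩
  rw [← nsmul_eq_mul]
  exact Finset.sum_le_card_nsmul _ _ _ hmax

theorem IsBAPU.sum_smulLeftCLM_eq {𝓘 : Set (Set ℝ)} {ψ : 𝓘 → 𝓢(ℝ, ℂ)} (hψ : IsBAPU 𝓘 ψ)
    {φ : 𝓢(ℝ, ℂ)} {T : Finset 𝓘} (hT : ∀ ξ, φ ξ ≠ 0 → ∀ I : 𝓘, ξ ∈ (I : Set ℝ) → I ∈ T) :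
    ∑ I ∈ T, smulLeftCLM ℂ (ψ I) φ = φ := by
  ext ξ
  rw [_root_.sum_apply]
  simp only [smulLeftCLM_schwartz_apply]
  rw [← Finset.sum_mul]
  by_cases hξ : φ ξ = 0
  · rw [hξ, mul_zero]
  · have hsum : HasSum (fun I : 𝓘 => ψ I ξ) (∑ I ∈ T, ψ I ξ) :=
      hasSum_sum_of_ne_finset_zero fun I hI =>
        image_eq_zero_of_notMem_tsupport fun hmem => hI (hT ξ hξ I (hψ.supp I hmem))
    rw [hsum.unique (hψ.sum_eq_one ξ), one_mul]

theorem IsBAPU.exists_eLpNorm_segmentFun_le (hp : 1 ≤ p) {𝓘 : Set (Set ℝ)} {ψ : 𝓘 → 𝓢(ℝ, ℂ)}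
    (hψ : IsBAPU 𝓘 ψ) {φ : 𝓢(ℝ, ℂ)} {T : Finset 𝓘} (hT : T.Nonempty)
    (hφ : ∀ ξ, φ ξ ≠ 0 → ∀ I : 𝓘, ξ ∈ (I : Set ℝ) → I ∈ T) (f : 𝓢'(ℝ, ℂ)) :
    ∃ I ∈ T, eLpNorm (segmentFun φ f) p volume ≤
      T.card * (fourierL1Norm φ * eLpNorm (segmentFun (ψ I) f) p volume) := by
  obtain ⟨I, hI, hle⟩ :=
    exists_mem_eLpNorm_segmentFun_sum_le hp hT (fun I => smulLeftCLM ℂ (ψ I) φ) f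
  rw [hψ.sum_smulLeftCLM_eq hφ] at hle
  exact ⟨I, hI, hle.trans (by gcongr; exact eLpNorm_segmentFun_smulLeftCLM_le hp _ _ f)⟩

theorem rescale_eq_zero {χ : 𝓢(ℝ, ℂ)} (hχ : ∀ ξ, 1 ≤ |ξ| → χ ξ = 0) {b h ξ : ℝ} (hh : 0 < h)
    (hξ : h ≤ |ξ - b|) : rescale b h hh χ ξ = 0 := by
  rw [rescale_apply]
  exact hχ _ (by rwa [abs_div, abs_of_pos hh, one_le_div hh])

theorem sum_rescale_eq_one {χ : 𝓢(ℝ, ℂ)} {M : ℕ}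
    (hχ : ∀ t : ℝ, |t| ≤ M → ∑ j ∈ Finset.range (2 * M + 1), χ (t - ((j : ℝ) - M)) = 1)
    {b h ξ : ℝ} (hh : 0 < h) (hξ : |ξ - b| ≤ M * h) :
    ∑ j ∈ Finset.range (2 * M + 1), rescale (b + h * ((j : ℝ) - M)) h hh χ ξ = 1 := by
  have harg (j : ℕ) : (ξ - (b + h * ((j : ℝ) - M))) / h = (ξ - b) / h - ((j : ℝ) - M) := by
    field_simp
    ring
  simp only [rescale_apply, harg]
  exact hχ _ (by rwa [abs_div, abs_of_pos hh, div_le_iff₀ hh])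

theorem exists_eLpNorm_segmentFun_le_rescale (hp : 1 ≤ p) {χ : 𝓢(ℝ, ℂ)} {M : ℕ}
    (hχ0 : ∀ ξ, 1 ≤ |ξ| → χ ξ = 0)
    (hχ : ∀ t : ℝ, |t| ≤ M → ∑ j ∈ Finset.range (2 * M + 1), χ (t - ((j : ℝ) - M)) = 1)
    {S : Set ℝ} (hS : S.Nonempty) {b h : ℝ} (hh : 0 < h) (hSb : ∀ ξ ∈ S, |ξ - b| ≤ M * h)
    {φ : 𝓢(ℝ, ℂ)} (hφ : ∀ ξ, φ ξ ≠ 0 → ξ ∈ S) (f : 𝓢'(ℝ, ℂ)) :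
    ∃ z, (∃ ξ ∈ S, |ξ - z| < h) ∧ eLpNorm (segmentFun φ f) p volume ≤
      (2 * M + 1 : ℕ) * eLpNorm (segmentFun (smulLeftCLM ℂ (rescale z h hh χ) φ) f) p volume := by
  classical
  let X (j : ℕ) : 𝓢(ℝ, ℂ) := rescale (b + h * ((j : ℝ) - M)) h hh χ
  let T : Finset ℕ :=
    {j ∈ Finset.range (2 * M + 1) | ∃ ξ ∈ S, |ξ - (b + h * ((j : ℝ) - M))| < h}
  have hsum (ξ : ℝ) (hξ : ξ ∈ S) : ∑ j ∈ T, X j ξ = 1 := by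
    rw [← sum_rescale_eq_one hχ hh (hSb ξ hξ)]
    refine Finset.sum_filter_of_ne fun j _ hj => ⟨ξ, hξ, ?_⟩
    exact lt_of_not_ge fun h => hj (rescale_eq_zero hχ0 hh h)
  have hT : T.Nonempty := by
    obtain ⟨ξ, hξ⟩ := hS
    exact Finset.nonempty_of_sum_ne_zero (hsum ξ hξ ▸ one_ne_zero)
  have hdecomp : ∑ j ∈ T, smulLeftCLM ℂ (X j) φ = φ := by
    ext ξ
    rw [_root_.sum_apply]
    simp only [smulLeftCLM_schwartz_apply]
    rw [← Finset.sum_mul]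
    by_cases hξ : φ ξ = 0
    · rw [hξ, mul_zero]
    · rw [hsum ξ (hφ ξ hξ), one_mul]
  obtain ⟨j, hj, hle⟩ :=
    exists_mem_eLpNorm_segmentFun_sum_le hp hT (fun j => smulLeftCLM ℂ (X j) φ) f
  rw [hdecomp] at hle
  refine ⟨_, (Finset.mem_filter.1 hj).2, hle.trans ?_⟩
  gcongr
  exact (Finset.card_filter_le _ _).trans_eq (Finset.card_range _)

end Localization

section LocalBounds

variable {α c : ℝ} {hc : 0 < c} {g : 𝓢(ℝ, ℂ)} {𝓘 : Set (Set ℝ)} {ψ : 𝓘 → 𝓢(ℝ, ℂ)} {ω : 𝓘 → ℝ}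
  {p : ℝ≥0∞}

theorem IsAlphaCovering.exists_near_of_abs_sub_le (hα : α ≤ 1) (h𝓘 : IsAlphaCovering α 𝓘) {κ : ℝ}
    (hκ : 0 ≤ κ) (hκ1 : κ < 1) : ∃ R, 0 ≤ R ∧ ∀ I ∈ 𝓘, ∀ ξ ∈ I, ∀ ω ∈ I, ∀ x,
      |ξ - x| ≤ κ * (1 + |x|) ^ α → Near α R x ω := by
  obtain ⟨B, hB, hnear⟩ := h𝓘.exists_near
  have : 0 < 1 - κ := sub_pos.2 hκ1
  refine ⟨_, ?_, fun I hI ξ hξ ω hω x hx => (Near.of_abs_sub_le hα hκ hκ1 hx).symm.trans hα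
    (by positivity) hB (hnear I hI ξ hξ ω hω)⟩
  positivity

theorem IsAlphaCovering.exists_near_and_scale_le (hα : α ≤ 1) (h𝓘 : IsAlphaCovering α 𝓘) {r : ℝ}
    (hr : 0 < r) : ∃ R δ, 0 ≤ R ∧ 0 < δ ∧ ∀ I ∈ 𝓘, ∀ ξ ∈ I, ∀ ω ∈ I, ∀ x,
      |x - ξ| ≤ δ * (1 + |ω|) ^ α → Near α R x ω ∧ δ * (1 + |ω|) ^ α ≤ r * (1 + |x|) ^ α := by
  obtain ⟨B, hB, hnear⟩ := h𝓘.exists_near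
  let K : ℝ := 1 / 2 * (1 - 1 / 2)⁻¹ ^ |α|
  have hK : 0 ≤ K := by positivity
  let R : ℝ := K * (1 + B) ^ |α| + B * (1 + K) ^ |α|
  have hR : 0 ≤ R := by positivity
  let δ : ℝ := min (1 / 2 / (1 + B) ^ |α|) (r / (1 + R) ^ |α|)
  have hδB : δ * (1 + B) ^ |α| ≤ 1 / 2 := (le_div_iff₀ (by positivity)).1 (min_le_left _ _)
  have hδR : δ * (1 + R) ^ |α| ≤ r := (le_div_iff₀ (by positivity)).1 (min_le_right _ _)
  have hδ : 0 < δ := lt_min (by positivity) (by positivity)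
  refine ⟨R, δ, hR, hδ, fun I hI ξ hξ ω hω x hx => ?_⟩
  have hxξ : |x - ξ| ≤ 1 / 2 * (1 + |ξ|) ^ α := by
    calc |x - ξ| ≤ δ * ((1 + B) ^ |α| * (1 + |ξ|) ^ α) :=
          hx.trans (by gcongr; exact (hnear I hI ω hω ξ hξ).rpow_le hα hB α)
      _ ≤ 1 / 2 * (1 + |ξ|) ^ α := by rw [← mul_assoc]; gcongr
  have hxω : Near α R x ω := (Near.of_abs_sub_le hα (by norm_num) (by norm_num) hxξ).trans hα hK hB
    (hnear I hI ξ hξ ω hω)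
  refine ⟨hxω, ?_⟩
  calc δ * (1 + |ω|) ^ α ≤ δ * ((1 + R) ^ |α| * (1 + |x|) ^ α) := by
        gcongr; exact hxω.symm.rpow_le hα hR α
    _ ≤ r * (1 + |x|) ^ α := by rw [← mul_assoc]; gcongr

theorem exists_eLpNorm_atomSymbol_le_segment (hα : α ≤ 1) (hp : 1 ≤ p)
    (hg : tsupport (𝓕 g : 𝓢(ℝ, ℂ)) ⊆ Metric.ball 0 c) (h𝓘 : IsAlphaCovering α 𝓘)
    (hψ : IsBAPU 𝓘 ψ) (hω : ∀ I : 𝓘, ω I ∈ (I : Set ℝ)) :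
    ∃ (R : ℝ) (C : ℝ≥0∞), 0 ≤ R ∧ C ≠ ∞ ∧ ∀ (f : 𝓢'(ℝ, ℂ)) (x : ℝ), ∃ I : 𝓘,
      Near α R x (ω I) ∧ eLpNorm (segmentFun (atomSymbol α c hc g x) f) p volume ≤
        C * ENNReal.ofReal ((1 + |x|) ^ (-α / 2)) * eLpNorm (segmentFun (ψ I) f) p volume := by
  obtain ⟨κ, hκ, hκ1, hsymbol⟩ := exists_lt_one_atomSymbol_eq_zero (α := α) (hc := hc) hg
  obtain ⟨R, hR, hnear⟩ := h𝓘.exists_near_of_abs_sub_le hα hκ hκ1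
  obtain ⟨N, hN⟩ := h𝓘.exists_encard_near_le hα hω hR
  set K := fourierL1Norm (conjSchwartz (𝓕 g))
  refine ⟨R, N * (ENNReal.ofReal (c ^ (1 / 2 : ℝ)) * K), hR,
    ENNReal.mul_ne_top (ENNReal.natCast_ne_top N)
      (ENNReal.mul_ne_top ENNReal.ofReal_ne_top (fourierL1Norm_lt_top _).ne), fun f x => ?_⟩
  have hfinite : {I : 𝓘 | Near α R x (ω I)}.Finite := Set.finite_of_encard_le_coe (hN x)
  have hmem (ξ : ℝ) (hξ : |ξ - x| ≤ κ * (1 + |x|) ^ α) (I : 𝓘) (hI : ξ ∈ (I : Set ℝ)) :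
      I ∈ hfinite.toFinset := hfinite.mem_toFinset.2 (hnear I I.2 ξ hI (ω I) (hω I) x hξ)
  have hnonempty : hfinite.toFinset.Nonempty := by
    obtain ⟨I, hI, hxI⟩ : x ∈ ⋃₀ 𝓘 := h𝓘.covers ▸ Set.mem_univ x
    exact ⟨⟨I, hI⟩, hmem x (by rw [sub_self, abs_zero]; positivity) ⟨I, hI⟩ hxI⟩
  obtain ⟨I, hI, hle⟩ := hψ.exists_eLpNorm_segmentFun_le hp hnonempty
    (fun ξ hξ => hmem ξ (le_of_not_ge fun h => hξ (hsymbol x ξ h))) f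
  refine ⟨I, hfinite.mem_toFinset.1 hI, hle.trans ?_⟩
  have hcard : hfinite.toFinset.card ≤ N := by
    exact_mod_cast hfinite.encard_eq_coe_toFinset_card ▸ hN x
  calc _ ≤ N * (fourierL1Norm (atomSymbol α c hc g x) *
        eLpNorm (segmentFun (ψ I) f) p volume) := by gcongr
    _ = _ := by rw [fourierL1Norm_atomSymbol]; ring

theorem eLpNorm_segmentFun_rescale_le_atomSymbol (hp : 1 ≤ p) {χ η : 𝓢(ℝ, ℂ)} {r z h x : ℝ}
    (hχ : ∀ ξ, 1 ≤ |ξ| → χ ξ = 0) (hη : ∀ ξ, |ξ| ≤ r * c → η ξ * conj ((𝓕 g : 𝓢(ℝ, ℂ)) ξ) = 1)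
    (hh : 0 < h) (hx : |x - z| ≤ h) (hr : 2 * h ≤ r * (1 + |x|) ^ α) (φ : 𝓢(ℝ, ℂ))
    (f : 𝓢'(ℝ, ℂ)) :
    eLpNorm (segmentFun (smulLeftCLM ℂ (rescale z h hh χ) φ) f) p volume ≤
      ENNReal.ofReal (c ^ (-1 / 2 : ℝ)) * (fourierL1Norm φ * fourierL1Norm χ * fourierL1Norm η) *
        ENNReal.ofReal ((1 + |x|) ^ (α / 2)) *
          eLpNorm (segmentFun (atomSymbol α c hc g x) f) p volume := by
  have hsupp (ξ : ℝ) (hξ : smulLeftCLM ℂ (rescale z h hh χ) φ ξ ≠ 0) :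
      |ξ - x| ≤ r * (1 + |x|) ^ α := by
    have hξz : |ξ - z| < h := lt_of_not_ge fun hle => hξ <| by
      rw [smulLeftCLM_schwartz_apply, rescale_eq_zero hχ hh hle, zero_mul]
    linarith [abs_sub_le ξ z x, abs_sub_comm z x]
  have hnorm : fourierL1Norm (smulLeftCLM ℂ (rescale z h hh χ) φ) ≤
      fourierL1Norm φ * fourierL1Norm χ :=
    (fourierL1Norm_smulLeftCLM_le _ _).trans_eq (by rw [fourierL1Norm_rescale])
  calc _ ≤ ENNReal.ofReal (c ^ (-1 / 2 : ℝ)) * ENNReal.ofReal ((1 + |x|) ^ (α / 2)) *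
        (fourierL1Norm φ * fourierL1Norm χ * (fourierL1Norm η *
          eLpNorm (segmentFun (atomSymbol α c hc g x) f) p volume)) :=
        (eLpNorm_segmentFun_le_atomSymbol hp hη hsupp f).trans (by gcongr)
    _ = _ := by ring

theorem exists_eLpNorm_segment_le_atomSymbol (hα : α ≤ 1) (hp : 1 ≤ p)
    (hg : (𝓕 g : 𝓢(ℝ, ℂ)) 0 ≠ 0) (h𝓘 : IsAlphaCovering α 𝓘) (hψ : IsBAPU 𝓘 ψ)
    (hω : ∀ I : 𝓘, ω I ∈ (I : Set ℝ)) :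
    ∃ (R δ : ℝ) (C : ℝ≥0∞), 0 ≤ R ∧ 0 < δ ∧ C ≠ ∞ ∧ ∀ (f : 𝓢'(ℝ, ℂ)) (I : 𝓘), ∃ J : Set ℝ,
      MeasurableSet J ∧ volume J = ENNReal.ofReal (δ * (1 + |ω I|) ^ α) ∧
      ∀ x ∈ J, Near α R x (ω I) ∧ eLpNorm (segmentFun (ψ I) f) p volume ≤
        C * ENNReal.ofReal ((1 + |x|) ^ (α / 2)) *
          eLpNorm (segmentFun (atomSymbol α c hc g x) f) p volume := by
  obtain ⟨B, -, hB⟩ := h𝓘.exists_near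
  obtain ⟨Cψ, hCψ⟩ : ∃ C : ℝ≥0, ∀ I, fourierL1Norm (ψ I) ≤ C := hψ.bounded
  obtain ⟨χ, hχ0, hχ⟩ := exists_schwartz_translation_partition
  obtain ⟨η, ρ, hρ, hη⟩ := exists_schwartz_mul_eq_one (φ := conjSchwartz (𝓕 g))
    (by rwa [conjSchwartz_apply, map_ne_zero])
  obtain ⟨R, δ, hR, hδ, hnear⟩ := h𝓘.exists_near_and_scale_le hα (div_pos hρ hc)
  obtain ⟨M, hM⟩ := exists_nat_ge (B / (δ / 2))
  rw [div_le_iff₀ (by positivity)] at hM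
  refine ⟨R, δ, (2 * M + 1 : ℕ) * (ENNReal.ofReal (c ^ (-1 / 2 : ℝ)) *
      (Cψ * fourierL1Norm χ * fourierL1Norm η)), hR, hδ,
    ENNReal.mul_ne_top (ENNReal.natCast_ne_top _) (ENNReal.mul_ne_top ENNReal.ofReal_ne_top
      (ENNReal.mul_ne_top (ENNReal.mul_ne_top ENNReal.coe_ne_top (fourierL1Norm_lt_top χ).ne)
        (fourierL1Norm_lt_top η).ne)), fun f I => ?_⟩
  set h : ℝ := δ / 2 * (1 + |ω I|) ^ α with hdef
  have hh : 0 < h := by positivity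
  have hsub (ξ : ℝ) (hξ : ξ ∈ (I : Set ℝ)) : |ξ - ω I| ≤ M * h := by
    rw [hdef, ← mul_assoc]
    exact (hB I I.2 ξ hξ (ω I) (hω I)).2.trans (by gcongr)
  obtain ⟨z, ⟨ξ₀, hξ₀I, hξ₀z⟩, hle⟩ := exists_eLpNorm_segmentFun_le_rescale hp hχ0 (hχ M)
    ⟨ω I, hω I⟩ hh hsub (fun ξ hξ => hψ.supp I (subset_tsupport _ hξ)) f
  refine ⟨Metric.closedBall z h, Metric.isClosed_closedBall.measurableSet, ?_, fun x hx => ?_⟩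
  · rw [Real.volume_closedBall, hdef]
    ring_nf
  rw [Metric.mem_closedBall, Real.dist_eq] at hx
  obtain ⟨hxω, hscale⟩ := hnear I I.2 ξ₀ hξ₀I (ω I) (hω I) x
    (by linarith [abs_sub_le x z ξ₀, abs_sub_comm z ξ₀])
  refine ⟨hxω, hle.trans ?_⟩
  have hwindow := eLpNorm_segmentFun_rescale_le_atomSymbol (hc := hc) (g := g) (α := α) (r := ρ / c)
    hp hχ0 (fun ξ hξ => hη ξ (by rwa [div_mul_cancel₀ _ hc.ne'] at hξ)) hh hx (by linarith) (ψ I) f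
  calc _ ≤ (2 * M + 1 : ℕ) * (ENNReal.ofReal (c ^ (-1 / 2 : ℝ)) *
        (Cψ * fourierL1Norm χ * fourierL1Norm η) * ENNReal.ofReal ((1 + |x|) ^ (α / 2)) *
          eLpNorm (segmentFun (atomSymbol α c hc g x) f) p volume) := by
        grw [hwindow, hCψ I]
    _ = _ := by ring

end LocalBounds

theorem mixedNorm_alphaTransform (α c : ℝ) (hc : 0 < c) (g : 𝓢(ℝ, ℂ)) (p q : ℝ≥0∞) (s : ℝ)
    (f : 𝓢'(ℝ, ℂ)) :
    mixedNorm p q (freqWeight s) (alphaTransform α c hc g f) =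
      eLpNorm (fun x : ℝ => ENNReal.ofReal ((1 + |x|) ^ s) *
        eLpNorm (segmentFun (atomSymbol α c hc g x) f) p volume) q volume := by
  rw [mixedNorm]
  congr 1
  funext x
  have hslice : (fun t : ℝ => (freqWeight s (t, x) : ℂ) * alphaTransform α c hc g f (t, x)) =
      (((1 + |x|) ^ s : ℝ) : ℂ) • segmentFun (atomSymbol α c hc g x) f := by
    funext t
    rw [alphaTransform_eq_segmentFun]
    rfl
  rw [hslice, eLpNorm_const_smul, ← ofReal_norm, Complex.norm_real,
    Real.norm_of_nonneg (by positivity)]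

theorem modNorm_eq_lqNorm_segmentFun {p : ℝ≥0∞} (hp : 1 ≤ p) (q : ℝ≥0∞) (𝓘 : Set (Set ℝ))
    (ψ : 𝓘 → 𝓢(ℝ, ℂ)) (ω : 𝓘 → ℝ) (s α : ℝ) (f : 𝓢'(ℝ, ℂ)) :
    modNorm 𝓘 ψ ω p q (s + α * ((q⁻¹).toReal - 1 / 2)) f =
      lqNorm q fun I : 𝓘 => eLpNorm (segmentFun (ψ I) f) p volume *
        ENNReal.ofReal ((1 + |ω I|) ^ (s - α / 2)) *
          ENNReal.ofReal ((1 + |ω I|) ^ α) ^ (q⁻¹).toReal := by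
  rw [modNorm]
  congr 1
  funext I
  rw [distLpNorm_segmentation hp, mul_assoc,
    ENNReal.ofReal_rpow_of_nonneg (by positivity) ENNReal.toReal_nonneg,
    ← ENNReal.ofReal_mul (by positivity), ← Real.rpow_mul (by positivity),
    ← Real.rpow_add (by positivity)]
  congr 3
  ring

theorem ofReal_rpow_mul_ofReal_rpow (x a b : ℝ) :
    ENNReal.ofReal ((1 + |x|) ^ a) * ENNReal.ofReal ((1 + |x|) ^ b) =
      ENNReal.ofReal ((1 + |x|) ^ (a + b)) := by
  rw [← ENNReal.ofReal_mul (by positivity), ← Real.rpow_add (by positivity)]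

section Equivalence

variable {α c : ℝ} {hc : 0 < c} {g : 𝓢(ℝ, ℂ)} {𝓘 : Set (Set ℝ)} {ψ : 𝓘 → 𝓢(ℝ, ℂ)} {ω : 𝓘 → ℝ}
  {p q : ℝ≥0∞}

theorem exists_mixedNorm_le_modNorm (s : ℝ) (hα : α ≤ 1) (hp : 1 ≤ p) (hq : q ≠ 0)
    (hg : tsupport (𝓕 g : 𝓢(ℝ, ℂ)) ⊆ Metric.ball 0 c) (h𝓘 : IsAlphaCovering α 𝓘)
    (hψ : IsBAPU 𝓘 ψ) (hω : ∀ I : 𝓘, ω I ∈ (I : Set ℝ)) :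
    ∃ C : ℝ≥0∞, C ≠ ∞ ∧ ∀ f : 𝓢'(ℝ, ℂ),
      mixedNorm p q (freqWeight s) (alphaTransform α c hc g f) ≤
        C * modNorm 𝓘 ψ ω p q (s + α * ((q⁻¹).toReal - 1 / 2)) f := by
  obtain ⟨R, C, hR, hC, hbound⟩ :=
    exists_eLpNorm_atomSymbol_le_segment (hc := hc) hα hp hg h𝓘 hψ hω
  have : Countable 𝓘 := h𝓘.countable
  refine ⟨C * ENNReal.ofReal ((1 + R) ^ |s - α / 2|) * ENNReal.ofReal (2 * R) ^ (q⁻¹).toReal,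
    ENNReal.mul_ne_top (ENNReal.mul_ne_top hC ENNReal.ofReal_ne_top)
      (ENNReal.rpow_ne_top_of_nonneg ENNReal.toReal_nonneg ENNReal.ofReal_ne_top), fun f => ?_⟩
  rw [mixedNorm_alphaTransform, modNorm_eq_lqNorm_segmentFun hp]
  refine eLpNorm_le_lqNorm hq (J := fun I => {x | Near α R x (ω I)})
    (fun I => measurableSet_near α R (ω I)) (fun I => ?_) fun x => ?_
  · rw [← ENNReal.ofReal_mul (by positivity)]
    exact volume_near_le α R (ω I)
  · obtain ⟨I, hI, hle⟩ := hbound f x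
    refine ⟨I, hI, ?_⟩
    calc _ ≤ ENNReal.ofReal ((1 + |x|) ^ s) * (C * ENNReal.ofReal ((1 + |x|) ^ (-α / 2)) *
          eLpNorm (segmentFun (ψ I) f) p volume) := by gcongr
      _ = C * ENNReal.ofReal ((1 + |x|) ^ (s - α / 2)) *
          eLpNorm (segmentFun (ψ I) f) p volume := by
          rw [sub_eq_add_neg, ← neg_div, ← ofReal_rpow_mul_ofReal_rpow]; ring
      _ ≤ C * (ENNReal.ofReal ((1 + R) ^ |s - α / 2|) *
          ENNReal.ofReal ((1 + |ω I|) ^ (s - α / 2))) *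
          eLpNorm (segmentFun (ψ I) f) p volume := by
          gcongr
          exact hI.ofReal_rpow_le hα hR _
      _ = _ := by ring

theorem exists_modNorm_le_mixedNorm (s : ℝ) (hα : α ≤ 1) (hp : 1 ≤ p) (hq : q ≠ 0)
    (hg : (𝓕 g : 𝓢(ℝ, ℂ)) 0 ≠ 0) (h𝓘 : IsAlphaCovering α 𝓘) (hψ : IsBAPU 𝓘 ψ)
    (hω : ∀ I : 𝓘, ω I ∈ (I : Set ℝ)) :
    ∃ C : ℝ≥0∞, C ≠ ∞ ∧ ∀ f : 𝓢'(ℝ, ℂ),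
      modNorm 𝓘 ψ ω p q (s + α * ((q⁻¹).toReal - 1 / 2)) f ≤
        C * mixedNorm p q (freqWeight s) (alphaTransform α c hc g f) := by
  obtain ⟨R, δ, C, hR, hδ, hC, hbound⟩ :=
    exists_eLpNorm_segment_le_atomSymbol (hc := hc) hα hp hg h𝓘 hψ hω
  obtain ⟨N, hN⟩ := h𝓘.exists_encard_near_le hα hω hR
  have : Countable 𝓘 := h𝓘.countable
  have hC' : C * ENNReal.ofReal ((1 + R) ^ |s - α / 2|) ≠ ∞ :=
    ENNReal.mul_ne_top hC ENNReal.ofReal_ne_top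
  refine ⟨C * ENNReal.ofReal ((1 + R) ^ |s - α / 2|) *
    (ENNReal.ofReal δ⁻¹ * N) ^ (q⁻¹).toReal, ENNReal.mul_ne_top hC'
      (ENNReal.rpow_ne_top_of_nonneg ENNReal.toReal_nonneg
        (ENNReal.mul_ne_top ENNReal.ofReal_ne_top (ENNReal.natCast_ne_top N))), fun f => ?_⟩
  rw [mixedNorm_alphaTransform, modNorm_eq_lqNorm_segmentFun hp]
  choose J hJm hJv hJ using hbound f
  refine lqNorm_le_eLpNorm hq hC' hJm (fun I => ?_) (fun I => ?_) (fun I x hx => ?_)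
    fun x => (Set.encard_le_encard fun I hI => (hJ I x hI).1).trans (hN x)
  · rw [hJv]
    exact (ENNReal.ofReal_pos.2 (by positivity)).ne'
  · rw [hJv, ← ENNReal.ofReal_mul (by positivity), inv_mul_cancel_left₀ hδ.ne']
  · obtain ⟨hI, hle⟩ := hJ I x hx
    set v := eLpNorm (segmentFun (atomSymbol α c hc g x) f) p volume
    calc _ ≤ (C * ENNReal.ofReal ((1 + |x|) ^ (α / 2)) * v) *
          (ENNReal.ofReal ((1 + R) ^ |s - α / 2|) *
            ENNReal.ofReal ((1 + |x|) ^ (s - α / 2))) :=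
          mul_le_mul' hle (hI.symm.ofReal_rpow_le hα hR _)
      _ = C * ENNReal.ofReal ((1 + R) ^ |s - α / 2|) *
          (ENNReal.ofReal ((1 + |x|) ^ (s - α / 2)) * ENNReal.ofReal ((1 + |x|) ^ (α / 2)) *
            v) := by ring
      _ = _ := by rw [ofReal_rpow_mul_ofReal_rpow, sub_add_cancel]

end Equivalence

theorem isBandLimited_of_tsupport_subset_ball {g : 𝓢(ℝ, ℂ)} {r : ℝ}
    (hg : tsupport (𝓕 g : 𝓢(ℝ, ℂ)) ⊆ Metric.ball 0 r) : IsBandLimited g :=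
  (isCompact_closedBall (0 : ℝ) r).of_isClosed_subset (isClosed_tsupport _)
    (hg.trans Metric.ball_subset_closedBall)

theorem exists_window {r : ℝ} (hr : 0 < r) :
    ∃ g : 𝓢(ℝ, ℂ), (𝓕 g : 𝓢(ℝ, ℂ)) 0 ≠ 0 ∧ tsupport (𝓕 g : 𝓢(ℝ, ℂ)) ⊆ Metric.ball 0 r := by
  obtain ⟨θ, hθ1, hθ0⟩ :=
    exists_schwartz_cutoff (r := r / 4) (R := r / 2) (by positivity) (by linarith)
  refine ⟨𝓕⁻ θ, ?_, ?_⟩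
  · rw [FourierTransform.fourier_fourierInv_eq, hθ1 0 (by rw [abs_zero]; positivity)]
    exact one_ne_zero
  · rw [FourierTransform.fourier_fourierInv_eq]
    refine (closure_minimal (fun ξ hξ => ?_) Metric.isClosed_closedBall).trans
      (Metric.closedBall_subset_ball (half_lt_self hr))
    rw [mem_closedBall_zero_iff, Real.norm_eq_abs]
    exact le_of_not_ge fun h => hξ (hθ0 ξ h)

end AlphaMod

end

open AlphaMod in
theorem mainTheorem5_general {α c : ℝ} (s : ℝ) (hα : α ≤ 1) (hc : 0 < c) {p q : ℝ≥0∞}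
    (hp : 1 ≤ p) (hq : q ≠ 0) {g : 𝓢(ℝ, ℂ)} (hg0 : (𝓕 g : 𝓢(ℝ, ℂ)) 0 ≠ 0)
    (hg : tsupport (𝓕 g : 𝓢(ℝ, ℂ)) ⊆ Metric.ball 0 c) {𝓘 : Set (Set ℝ)} {ψ : 𝓘 → 𝓢(ℝ, ℂ)}
    {ω : 𝓘 → ℝ} (h𝓘 : IsAlphaCovering α 𝓘) (hψ : IsBAPU 𝓘 ψ)
    (hω : ∀ I : 𝓘, ω I ∈ (I : Set ℝ)) :
    modSpace 𝓘 ψ ω p q (s + α * ((q⁻¹).toReal - 1 / 2)) =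
        {f : 𝓢'(ℝ, ℂ) | MemMixed p q (freqWeight s) (alphaTransform α c hc g f)} ∧
      ∃ A B : ℝ≥0, 0 < A ∧ 0 < B ∧ ∀ f : 𝓢'(ℝ, ℂ),
        A * mixedNorm p q (freqWeight s) (alphaTransform α c hc g f) ≤
            modNorm 𝓘 ψ ω p q (s + α * ((q⁻¹).toReal - 1 / 2)) f ∧
          modNorm 𝓘 ψ ω p q (s + α * ((q⁻¹).toReal - 1 / 2)) f ≤
            B * mixedNorm p q (freqWeight s) (alphaTransform α c hc g f) := by
  obtain ⟨C₁, hC₁, h₁⟩ := exists_mixedNorm_le_modNorm (hc := hc) s hα hp hq hg h𝓘 hψ hω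
  obtain ⟨C₂, hC₂, h₂⟩ := exists_modNorm_le_mixedNorm (hc := hc) s hα hp hq hg0 h𝓘 hψ hω
  lift C₁ to ℝ≥0 using hC₁
  lift C₂ to ℝ≥0 using hC₂
  refine ⟨Set.ext fun f => ⟨fun hf => ⟨?_, ?_⟩, fun hf => ?_⟩, (C₁ + 1)⁻¹, C₂ + 1, by positivity,
    by positivity, fun f => ⟨?_, (h₂ f).trans ?_⟩⟩
  · exact (stronglyMeasurable_alphaTransform α c hc
      (isBandLimited_of_tsupport_subset_ball hg) f).aestronglyMeasurable
  · exact (h₁ f).trans_lt (ENNReal.mul_lt_top ENNReal.coe_lt_top hf)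
  · exact (h₂ f).trans_lt (ENNReal.mul_lt_top ENNReal.coe_lt_top hf.2)
  · rw [ENNReal.coe_inv (by positivity),
      ENNReal.inv_mul_le_iff (by positivity) ENNReal.coe_ne_top]
    refine (h₁ f).trans ?_
    gcongr
    exact le_self_add
  · gcongr
    exact le_self_add

theorem mainTheorem5 (s α c : ℝ) (hα : α ∈ Set.Icc (0 : ℝ) 1) (hc : 0 < c)
    (p q : ℝ≥0∞) (hp : 1 ≤ p) (hq : 1 ≤ q) :
    ∃ g : 𝓢(ℝ, ℂ), g ≠ 0 ∧ AlphaMod.IsBandLimited g ∧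
      ∀ (𝓘 : Set (Set ℝ)) (ψ : 𝓘 → 𝓢(ℝ, ℂ)) (ω : 𝓘 → ℝ),
        AlphaMod.IsAlphaCovering α 𝓘 → AlphaMod.IsBAPU 𝓘 ψ → (∀ I : 𝓘, ω I ∈ (I : Set ℝ)) →
          AlphaMod.modSpace 𝓘 ψ ω p q (s + α * ((q⁻¹).toReal - 1 / 2)) =
              {f : 𝓢'(ℝ, ℂ) | AlphaMod.MemMixed p q (AlphaMod.freqWeight s)
                (AlphaMod.alphaTransform α c hc g f)} ∧
            ∃ A B : ℝ≥0, 0 < A ∧ 0 < B ∧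
              ∀ f ∈ AlphaMod.modSpace 𝓘 ψ ω p q (s + α * ((q⁻¹).toReal - 1 / 2)),
                A * AlphaMod.mixedNorm p q (AlphaMod.freqWeight s)
                      (AlphaMod.alphaTransform α c hc g f) ≤
                    AlphaMod.modNorm 𝓘 ψ ω p q (s + α * ((q⁻¹).toReal - 1 / 2)) f ∧
                  AlphaMod.modNorm 𝓘 ψ ω p q (s + α * ((q⁻¹).toReal - 1 / 2)) f ≤
                    B * AlphaMod.mixedNorm p q (AlphaMod.freqWeight s)
                      (AlphaMod.alphaTransform α c hc g f) := by
  obtain ⟨g, hg0, hg⟩ := AlphaMod.exists_window hc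
  refine ⟨g, fun h => hg0 ?_, AlphaMod.isBandLimited_of_tsupport_subset_ball hg,
    fun 𝓘 ψ ω h𝓘 hψ hω => ?_⟩
  · rw [h, FourierTransform.fourier_zero, _root_.zero_apply]
  · obtain ⟨hspace, A, B, hA, hB, hle⟩ := mainTheorem5_general s hα.2 hc hp
      (zero_lt_one.trans_le hq).ne' hg0 hg h𝓘 hψ hω
    exact ⟨hspace, A, B, hA, hB, fun f _ => hle f⟩
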